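/- **Lemma (Claw Property).** Let $G=(V,E,c)$ be a finite graph with edge costs $c\ge 0$, let $d$ be the shortest-path distance ($d=\infty$ if there is no path), let $t:V\to\mathbb R_{\ge0}$ and $0<\beta<1$. *Moat growing.* Given $t':V\to\mathbb R_{\ge0}$, the moat-growing execution with fingerprint $t'$ runs in continuous time from moment $0$, with growths $y_S=0$ for all $S\subseteq V$ at the start. At each moment an edge $e$ is fully coloured if $\sum_{S:\,e\in\delta(S)}y_S=c_e$, where $\delta(S)$ is the set of edges with exactly one endpoint in $S$; the components are the connected components of $V$ with respect to the fully coloured edges; a component $S$ is active at moment $\tau$ if $t'_a>\tau$ for some $a\in S$; and $y_S$ grows at unit rate exactly for the active $S$. Deactivation is checked after merging, so a component just formed from an active set counts as an active set at that moment, even if it is deactivated at once. Let $y_{\mathrm{base}}(t')$ be the total growth of active sets $S$ during moments $\tau$ with $\tau<t_a$ for some $a\in S$, and $y_{\mathrm{add}}(t')$ the total growth during the other moments. *Local search.* A boost $(a,\sigma)$ replaces the value $t'_a$ by $\sigma$, giving $t''$; it is valuable for $t'$ if $$y_{\mathrm{base}}(t')-y_{\mathrm{base}}(t'')\ \ge\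 (1+\beta)\,\bigl(y_{\mathrm{add}}(t'')-y_{\mathrm{add}}(t')\bigr).$$ The boosts considered for $t'$ are the pairs $(a,\sigma)$ such that $\sigma>t'_a$ and, in the execution in which $t'_a$ is replaced by a sufficiently large number, the active set containing $a$ merges with another active set at moment $\sigma$. Local search on $(G,t,\beta)$ starts with $t'=t$, repeatedly applies a considered valuable boost, and stops when there is none. *Claim.* Let $t'$ be the fingerprint at the end of a local search on $(G,t,\beta)$, and consider the execution with fingerprint $t'$. Let $u,v,w\in V$ connect actively, that is, each of them remains in active sets from the beginning until they all lie in a common component, which is an active set. Then there is a first moment $\tau$ at which at least two of $u,v,w$ belong to the same active set, and a first moment $\tau'$ at which all three belong to the same active set, and for every vertex $q$ $$\tau+\tau'\ \le\ \frac{d(q,u)+d(q,v)+d(q,w)}{2}+\beta\,\frac{\min\bigl(d(q,u),d(q,v),d(q,w)\bigr)}{2}.$$ -/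

import Mathlib

open scoped NNReal ENNReal

/-- A graph with nonnegative edge costs (only the values of `cost` on edges of `graph` matter). -/
structure CostGraph (V : Type*) where
  graph : SimpleGraph V
  cost : Sym2 V → ℝ≥0

namespace CostGraph

/-- Total cost of the edges of a walk. -/
noncomputable def walkCost {V : Type*} (G : CostGraph V) {a b : V} (p : G.graph.Walk a b) : ℝ≥0 :=
  (p.edges.map G.cost).sum

/-- Shortest-path distance; it is `⊤` when no path exists. -/
noncomputable def dist {V : Type*} (G : CostGraph V) (a b : V) : ℝ≥0∞ :=
  ⨅ p : G.graph.Walk a b, (G.walkCost p : ℝ≥0∞)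

/-- The data that moat growing maintains: the current moment and the growth `y_S` accumulated so far
by every set `S` of vertices. -/
structure State (V : Type*) where
  time : ℝ
  growth : Finset V → ℝ

open scoped Classical in
/-- The coloured length of the edge `ab`: the sum of `y_S` over the sets `S` that contain exactly one
of `a`, `b`. -/
noncomputable def State.colored {V : Type*} [Fintype V] (s : State V) (a b : V) : ℝ :=
  ∑ S : Finset V with (a ∈ S ↔ b ∉ S), s.growth S

/-- The graph of the fully coloured edges. (The coloured length of an edge never exceeds its cost,
so `≤` amounts to equality.) -/
def coloredGraph {V : Type*} [Fintype V] (G : CostGraph V) (s : State V) : SimpleGraph V where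
  Adj a b := G.graph.Adj a b ∧ (G.cost s(a, b) : ℝ) ≤ s.colored a b
  symm := ⟨fun a b h => by
    refine ⟨h.1.symm, ?_⟩
    have e : s.colored b a = s.colored a b := by
      unfold State.colored
      congr 1
      ext S
      simp only [Finset.mem_filter, Finset.mem_univ, true_and]
      tauto
    rw [e, Sym2.eq_swap]
    exact h.2⟩
  loopless := ⟨fun a h => G.graph.loopless.irrefl a h.1⟩

open scoped Classical in
/-- The connected component of `a` with respect to the fully coloured edges. -/
noncomputable def component {V : Type*} [Fintype V] (G : CostGraph V) (s : State V) (a : V) :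
    Finset V :=
  Finset.univ.filter fun b => (G.coloredGraph s).Reachable a b

open scoped Classical in
/-- All current connected components. -/
noncomputable def components {V : Type*} [Fintype V] (G : CostGraph V) (s : State V) :
    Finset (Finset V) :=
  Finset.univ.image (G.component s)

open scoped Classical in
/-- The active sets for the fingerprint `t`: the components that contain a vertex whose required
growing time is not yet over. -/
noncomputable def activeSets {V : Type*} [Fintype V] (G : CostGraph V) (t : V → ℝ≥0)
    (s : State V) : Finset (Finset V) :=
  (G.components s).filter fun S => ∃ a ∈ S, s.time < t a

open scoped Classical in
/-- The waiting times until an edge between two different components, at least one of which is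
active, becomes fully coloured, if nothing else happens before. -/
def edgeWaits {V : Type*} [Fintype V] (G : CostGraph V) (t : V → ℝ≥0) (s : State V) : Set ℝ :=
  {δ | ∃ a b, G.graph.Adj a b ∧ G.component s a ≠ G.component s b ∧
    (({G.component s a, G.component s b} : Finset (Finset V)) ∩ G.activeSets t s).Nonempty ∧
    δ = (G.cost s(a, b) - s.colored a b) /
      (({G.component s a, G.component s b} : Finset (Finset V)) ∩ G.activeSets t s).card}

/-- The waiting times until the required growing time of a vertex is over. -/
def vertexWaits {V : Type*} (t : V → ℝ≥0) (s : State V) : Set ℝ :=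
  {δ | ∃ a, s.time < t a ∧ δ = t a - s.time}

/-- The waiting time until the next event, the minimum of a finite set. This set is empty exactly
if there is no active set; the process is then over, and the value is `0`. -/
noncomputable def wait {V : Type*} [Fintype V] (G : CostGraph V) (t : V → ℝ≥0) (s : State V) : ℝ :=
  sInf (G.edgeWaits t s ∪ vertexWaits t s)

open scoped Classical in
/-- Let all active sets grow until the next event. -/
noncomputable def step {V : Type*} [Fintype V] (G : CostGraph V) (t : V → ℝ≥0) (s : State V) :
    State V where
  time := s.time + G.wait t s
  growth S := s.growth S + if S ∈ G.activeSets t s then G.wait t s else 0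

/-- The execution of moat growing with fingerprint `t`, from event to event. -/
noncomputable def run {V : Type*} [Fintype V] (G : CostGraph V) (t : V → ℝ≥0) : ℕ → State V
  | 0 => ⟨0, fun _ => 0⟩
  | n + 1 => G.step t (run G t n)

/-- The moment `τ` falls into the phase between the events `n` and `n + 1` (the phase in which there
is no active set any more lasts forever). -/
def InPhase {V : Type*} [Fintype V] (G : CostGraph V) (t : V → ℝ≥0) (n : ℕ) (τ : ℝ) : Prop :=
  (G.run t n).time ≤ τ ∧ (τ < (G.run t (n + 1)).time ∨ G.activeSets t (G.run t n) = ∅)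

/-- `S` is a connected component at the moment `τ` (after all merges at this moment). -/
def IsComponentAt {V : Type*} [Fintype V] (G : CostGraph V) (t : V → ℝ≥0) (τ : ℝ)
    (S : Finset V) : Prop :=
  ∃ n, G.InPhase t n τ ∧ S ∈ G.components (G.run t n)

/-- `S` is active and growing during `[τ, τ + ε)` for some `ε > 0`. -/
def GrowsAt {V : Type*} [Fintype V] (G : CostGraph V) (t : V → ℝ≥0) (τ : ℝ)
    (S : Finset V) : Prop :=
  ∃ n, G.InPhase t n τ ∧ S ∈ G.activeSets t (G.run t n)

/-- `S` is active and growing during `(τ - ε, τ)` for some `ε > 0`. -/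
def GrowsUntil {V : Type*} [Fintype V] (G : CostGraph V) (t : V → ℝ≥0) (τ : ℝ)
    (S : Finset V) : Prop :=
  ∃ n, (G.run t n).time < τ ∧ τ ≤ (G.run t (n + 1)).time ∧ S ∈ G.activeSets t (G.run t n)

/-- `S` is an active set at the moment `τ`. Deactivation is checked after the merges: a component
that has just been formed from an active set is active at this moment, even if it is deactivated
at once. -/
def IsActiveAt {V : Type*} [Fintype V] (G : CostGraph V) (t : V → ℝ≥0) (τ : ℝ)
    (S : Finset V) : Prop :=
  G.IsComponentAt t τ S ∧ (G.GrowsAt t τ S ∨ ∃ S' ⊆ S, G.GrowsUntil t τ S')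

/-- The vertices of `A` connect actively: all of them remain in active sets from the beginning until
a moment `σ` at which they lie in one and the same component, an active set (which may be
deactivated at once). -/
def ActivelyConnected {V : Type*} [Fintype V] (G : CostGraph V) (t : V → ℝ≥0) (A : Set V) : Prop :=
  ∃ σ : ℝ, (∃ S, G.IsActiveAt t σ S ∧ A ⊆ S) ∧
    ∀ a ∈ A, ∀ τ : ℝ, 0 ≤ τ → τ < σ → ∃ S, G.GrowsAt t τ S ∧ a ∈ S

open MeasureTheory in
/-- The base growth of the boosted instance `(G, t, t')`: the total growth of the active sets, in the
execution with the boosted fingerprint `t'`, while they contain a vertex `a` with `τ < t a`. -/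
noncomputable def yBase {V : Type*} [Fintype V] (G : CostGraph V) (t t' : V → ℝ≥0) : ℝ :=
  ∑ S : Finset V, volume.real {τ : ℝ | G.GrowsAt t' τ S ∧ ∃ a ∈ S, τ < t a}

open MeasureTheory in
/-- The additional growth of the boosted instance `(G, t, t')`: the total growth of the active sets
while they contain no vertex `a` with `τ < t a`. -/
noncomputable def yAdd {V : Type*} [Fintype V] (G : CostGraph V) (t t' : V → ℝ≥0) : ℝ :=
  ∑ S : Finset V, volume.real {τ : ℝ | G.GrowsAt t' τ S ∧ ∀ a ∈ S, t a ≤ τ}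

open scoped Classical in
/-- The boost action `(a, σ)` applied to the boosted fingerprint `t'`. -/
noncomputable def boost {V : Type*} (t' : V → ℝ≥0) (a : V) (σ : ℝ≥0) : V → ℝ≥0 :=
  Function.update t' a σ

/-- The decrease of the base growth caused by the boost `(a, σ)`. -/
noncomputable def win {V : Type*} [Fintype V] (G : CostGraph V) (t t' : V → ℝ≥0) (a : V)
    (σ : ℝ≥0) : ℝ :=
  G.yBase t t' - G.yBase t (boost t' a σ)

/-- The increase of the additional growth caused by the boost `(a, σ)`. -/
noncomputable def loss {V : Type*} [Fintype V] (G : CostGraph V) (t t' : V → ℝ≥0) (a : V)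
    (σ : ℝ≥0) : ℝ :=
  G.yAdd t (boost t' a σ) - G.yAdd t t'

/-- The boost `(a, σ)` is valuable. -/
def IsValuable {V : Type*} [Fintype V] (G : CostGraph V) (t : V → ℝ≥0) (β : ℝ) (t' : V → ℝ≥0)
    (a : V) (σ : ℝ≥0) : Prop :=
  (1 + β) * G.loss t t' a σ ≤ G.win t t' a σ

/-- The space of boost actions: `σ` exceeds `t' a`, and in the execution in which the value at `a` is
replaced by a sufficiently large number `T`, the active set containing `a` merges with another
active set at the moment `σ`. -/
def IsCandidate {V : Type*} [Fintype V] (G : CostGraph V) (t' : V → ℝ≥0) (a : V)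
    (σ : ℝ≥0) : Prop :=
  t' a < σ ∧ ∀ᶠ T : ℝ≥0 in Filter.atTop, ∃ S S' C : Finset V,
    a ∈ S ∧ S ≠ S' ∧ G.GrowsUntil (boost t' a T) σ S ∧ G.GrowsUntil (boost t' a T) σ S' ∧
    G.IsComponentAt (boost t' a T) σ C ∧ S ⊆ C ∧ S' ⊆ C

/-- One iteration of local search: some valuable boost of the boost space is applied. -/
def LocalSearchStep {V : Type*} [Fintype V] (G : CostGraph V) (t : V → ℝ≥0) (β : ℝ)
    (t₁ t₂ : V → ℝ≥0) : Prop :=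
  ∃ a σ, G.IsCandidate t₁ a σ ∧ G.IsValuable t β t₁ a σ ∧ t₂ = boost t₁ a σ

/-- `t'` is the boosted fingerprint at the end of a call of local search on `(G, t, β)`: it arises
from `t` by iterations, and no valuable boost remains. -/
def IsLocalSearchOutput {V : Type*} [Fintype V] (G : CostGraph V) (t : V → ℝ≥0) (β : ℝ)
    (t' : V → ℝ≥0) : Prop :=
  Relation.ReflTransGen (G.LocalSearchStep t β) t t' ∧
    ∀ a σ, G.IsCandidate t' a σ → ¬ G.IsValuable t β t' a σ

end CostGraph

/-!
Let `N τ` be the number of components that contain one of `u`, `v`, `w` at the moment `τ`. It is `3`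
before the first of the two moments and at least `2` before the second one, so the sum of these
moments is at most the integral of `N - 1` up to the second one.

To bound this integral for a given `q`, let `q` grow as long as needed and let `ρ x` be the moment
at which `q` joins `x`, for `x = u, v, w`. Both ends of a path from `q` to `x` grow until then, so
`2 * ρ x ≤ d(q, x)`. Let `σ` be the minimum of the `ρ x`. If `q` grows until `σ` anyway, or if `σ`
is too late to matter, then `N τ - 1` is at most the number of `x` with `τ < ρ x`, and the integral
is at most the sum of the `ρ x`. Otherwise `(q, σ)` is one of the boosts considered by local search,
so it is not valuable: it increases the total growth weighted by `1` for base growth and by `1 + β`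
for additional growth. It adds a set of weight at most `1 + β` until `σ`, while the component of `q`
absorbs `x` from `ρ x` on, and each component that disappears by merging saves a weight of at least
`1`. Comparing the two effects bounds the integral by the sum of the `ρ x` plus `β * σ`.
-/

open Filter Topology in
theorem exists_isLeast_of_frequently_nhdsGE {B : Set ℝ} {m : ℝ} (hne : B.Nonempty)
    (hm : m ∈ lowerBounds B) (hB : ∀ τ ≥ m, (∃ᶠ σ in 𝓝[≥] τ, σ ∈ B) → τ ∈ B) :
    ∃ τ, IsLeast B τ :=
  have hinf : IsGLB B (sInf B) := isGLB_csInf hne ⟨m, hm⟩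
  ⟨sInf B, hB _ (hinf.2 hm) (hinf.frequently_mem hne), hinf.1⟩

open Filter Topology in
theorem forall_ge_of_eventually_nhdsGE {P : ℝ → Prop} {m : ℝ}
    (hleft : ∀ τ ≥ m, (∀ σ ≥ m, σ < τ → P σ) → P τ)
    (hright : ∀ τ ≥ m, P τ → ∀ᶠ σ in 𝓝[≥] τ, P σ) : ∀ τ ≥ m, P τ := by
  by_contra! hfail
  have hbdd : BddBelow {τ | m ≤ τ ∧ ¬ P τ} := ⟨m, fun _ hτ => hτ.1⟩
  have hinf : m ≤ sInf {τ | m ≤ τ ∧ ¬ P τ} := le_csInf hfail fun _ hτ => hτ.1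
  have hP : P (sInf {τ | m ≤ τ ∧ ¬ P τ}) := hleft _ hinf fun σ hσ hlt => by
    by_contra hσP
    exact hlt.not_ge (csInf_le hbdd ⟨hσ, hσP⟩)
  obtain ⟨σ, hσ, hσP⟩ :=
    (((isGLB_csInf hfail hbdd).frequently_mem hfail).and_eventually (hright _ hinf hP)).exists
  exact hσ.2 hσP

theorem reachable_of_adj_reachable {V : Type*} {H K : SimpleGraph V}
    (h : ∀ a b, H.Adj a b → K.Reachable a b) {a b : V} (hab : H.Reachable a b) :
    K.Reachable a b := by
  obtain ⟨p⟩ := hab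
  induction p with
  | nil => exact .rfl
  | cons hadj _ ih => exact (h _ _ hadj).trans ih

theorem sum_union_le {α : Type*} [DecidableEq α] {A B : Finset α} {w : α → ℝ} (hw : ∀ a, 0 ≤ w a) :
    ∑ a ∈ A ∪ B, w a ≤ ∑ a ∈ A, w a + ∑ a ∈ B, w a := by
  rw [← Finset.sum_union_inter]
  exact le_add_of_nonneg_right (Finset.sum_nonneg fun a _ => hw a)

theorem card_image_add_card_le {α : Type*} [DecidableEq α] {A X : Finset α} {f : α → α}
    (hX : X ⊆ A) : (A.image f).card + X.card ≤ A.card + (X.image f).card := by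
  have hunion : A.image f = X.image f ∪ (A \ X).image f := by
    rw [← Finset.image_union, Finset.union_sdiff_of_subset hX]
  calc (A.image f).card + X.card
    _ ≤ (X.image f).card + (A \ X).card + X.card := by
      rw [hunion]
      gcongr
      exact (Finset.card_union_le _ _).trans (Nat.add_le_add_left Finset.card_image_le _)
    _ = A.card + (X.image f).card := by
      rw [add_assoc, Finset.card_sdiff_add_card_eq_card hX, add_comm]

theorem sum_image_add_card_le {α : Type*} [DecidableEq α] {A X : Finset α} {f : α → α} {w : α → ℝ}
    (hw : ∀ a, 1 ≤ w a) (hf : ∀ a, w (f a) ≤ w a) (hX : X ⊆ A) :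
    ∑ a ∈ A.image f, w a + X.card ≤ ∑ a ∈ A, w a + (X.image f).card := by
  have hsum : ∑ a ∈ A.image f, (w a - 1) ≤ ∑ a ∈ A, (w a - 1) :=
    (Finset.sum_image_le_of_nonneg (f := fun a => w a - 1) fun a _ => sub_nonneg.2 (hw a)).trans
      (Finset.sum_le_sum fun a _ => sub_le_sub_right (hf a) 1)
  have hcard : ((A.image f).card + X.card : ℝ) ≤ A.card + (X.image f).card := by
    exact_mod_cast card_image_add_card_le hX
  simp only [Finset.sum_sub_distrib, Finset.sum_const, nsmul_eq_mul, mul_one] at hsum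
  linarith

namespace CostGraph

open Filter Topology MeasureTheory

section

variable {V : Type*} {t : V → ℝ≥0} {S C : Finset V} {β τ : ℝ} {σ : ℝ≥0} {a q : V}

theorem boost_self : boost t q σ q = σ := by
  classical
  exact Function.update_self ..

theorem boost_of_ne (h : a ≠ q) : boost t q σ a = t a := by
  classical
  exact Function.update_of_ne h ..

theorem boost_eq_self : boost t q (t q) = t := by
  classical
  exact Function.update_eq_self ..

theorem le_boost (h : t q ≤ σ) : t ≤ boost t q σ := by
  classical
  exact le_update_iff.2 ⟨h, fun _ _ => le_rfl⟩

open scoped Classical in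
/-- The weight with which the growth of `S` at the moment `τ` counts: `1` for base growth and
`1 + β` for additional growth. A boost is valuable exactly if it does not increase the total
weighted growth. -/
noncomputable def weight (t : V → ℝ≥0) (β τ : ℝ) (S : Finset V) : ℝ :=
  if ∃ a ∈ S, τ < t a then 1 else 1 + β

theorem one_le_weight (hβ : 0 ≤ β) : 1 ≤ weight t β τ S := by
  unfold weight; split_ifs <;> linarith

theorem weight_le (hβ : 0 ≤ β) : weight t β τ S ≤ 1 + β := by
  unfold weight; split_ifs <;> linarith

theorem weight_anti (hβ : 0 ≤ β) (h : S ⊆ C) : weight t β τ C ≤ weight t β τ S := by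
  by_cases hS : ∃ a ∈ S, τ < t a
  · have hC : ∃ a ∈ C, τ < t a := hS.imp fun a ha => ⟨h ha.1, ha.2⟩
    rw [weight, weight, if_pos hS, if_pos hC]
  · exact (weight_le hβ).trans_eq (if_neg hS).symm

variable (t S) in
theorem measurableSet_exists_lt : MeasurableSet {τ : ℝ | ∃ a ∈ S, τ < t a} := by
  have hunion : {τ : ℝ | ∃ a ∈ S, τ < t a} = ⋃ a ∈ S, Set.Iio (t a : ℝ) := by ext; simp
  rw [hunion]
  exact S.measurableSet_biUnion fun _ _ => measurableSet_Iio

end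

variable {V : Type*} [Fintype V] {G : CostGraph V} {t t' t₁ t₂ : V → ℝ≥0} {s s' : State V}
  {a b q u v w : V} {S : Finset V} {n m : ℕ} {δ σ τ M β : ℝ}

theorem mem_component : b ∈ G.component s a ↔ (G.coloredGraph s).Reachable a b := by
  simp [component]

theorem self_mem_component : a ∈ G.component s a :=
  mem_component.2 .rfl

theorem component_eq_iff :
    G.component s a = G.component s b ↔ (G.coloredGraph s).Reachable a b := by
  refine ⟨fun h => mem_component.1 (h ▸ self_mem_component), fun h => ?_⟩
  ext c
  simp only [mem_component]
  exact ⟨h.symm.trans, h.trans⟩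

theorem mem_components : S ∈ G.components s ↔ ∃ a, G.component s a = S := by
  simp [components]

theorem component_eq_of_mem (hS : S ∈ G.components s) (ha : a ∈ S) : G.component s a = S := by
  obtain ⟨b, rfl⟩ := mem_components.1 hS
  exact (component_eq_iff.2 (mem_component.1 ha)).symm

theorem mem_activeSets :
    S ∈ G.activeSets t s ↔ S ∈ G.components s ∧ ∃ a ∈ S, s.time < t a := by
  simp only [activeSets, Finset.mem_filter]

theorem component_mem_activeSets :
    G.component s a ∈ G.activeSets t s ↔
      ∃ b, (G.coloredGraph s).Reachable a b ∧ s.time < t b := by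
  simp [mem_activeSets, mem_components, mem_component]

theorem component_mem_activeSets_of_lt (h : s.time < t a) :
    G.component s a ∈ G.activeSets t s :=
  component_mem_activeSets.2 ⟨a, .rfl, h⟩

theorem adj_coloredGraph :
    (G.coloredGraph s).Adj a b ↔ G.graph.Adj a b ∧ (G.cost s(a, b) : ℝ) ≤ s.colored a b :=
  Iff.rfl

theorem colored_lt_cost (hadj : G.graph.Adj a b) (h : ¬ (G.coloredGraph s).Reachable a b) :
    s.colored a b < G.cost s(a, b) := by
  contrapose! h
  exact SimpleGraph.Adj.reachable (adj_coloredGraph.2 ⟨hadj, h⟩)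

theorem reachable_of_colored_le (h : ∀ a b, s.colored a b ≤ s'.colored a b)
    (hab : (G.coloredGraph s).Reachable a b) : (G.coloredGraph s').Reachable a b :=
  hab.mono fun _ _ hadj => adj_coloredGraph.2
    ((adj_coloredGraph.1 hadj).imp_right fun hle => hle.trans (h _ _))

open scoped Classical in
/-- The active sets that contain exactly one of `a`, `b`: the coloured length of `ab` grows at the
rate given by their number. -/
noncomputable def separators (G : CostGraph V) (t : V → ℝ≥0) (s : State V) (a b : V) :
    Finset (Finset V) :=
  {S ∈ G.activeSets t s | a ∈ S ↔ b ∉ S}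

theorem separators_eq_empty (h : (G.coloredGraph s).Reachable a b) :
    G.separators t s a b = ∅ := by
  classical
  refine Finset.filter_false_of_mem fun S hS hsep => ?_
  obtain ⟨c, rfl⟩ := mem_components.1 (mem_activeSets.1 hS).1
  simp only [mem_component] at hsep
  have hc : (G.coloredGraph s).Reachable c a ↔ (G.coloredGraph s).Reachable c b :=
    ⟨fun h' => h'.trans h, fun h' => h'.trans h.symm⟩
  tauto

open scoped Classical in
theorem separators_eq_inter (h : ¬ (G.coloredGraph s).Reachable a b) :
    G.separators t s a b = {G.component s a, G.component s b} ∩ G.activeSets t s := by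
  ext S
  simp only [separators, Finset.mem_filter, Finset.mem_inter, Finset.mem_insert,
    Finset.mem_singleton, and_comm (a := S ∈ _), and_congr_left_iff]
  intro hS
  obtain ⟨c, rfl⟩ := mem_components.1 (mem_activeSets.1 hS).1
  simp only [component_eq_iff, mem_component]
  constructor
  · tauto
  · rintro (hac | hbc)
    · exact ⟨fun _ hcb => h (hac.symm.trans hcb), fun _ => hac⟩
    · exact ⟨fun hca _ => h (hca.symm.trans hbc), fun hcb => absurd hbc hcb⟩

open scoped Classical in
theorem card_separators (h : ¬ (G.coloredGraph s).Reachable a b) :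
    (G.separators t s a b).card =
      (if G.component s a ∈ G.activeSets t s then 1 else 0) +
        if G.component s b ∈ G.activeSets t s then 1 else 0 := by
  have hne : G.component s a ≠ G.component s b := fun h' => h (component_eq_iff.1 h')
  rw [separators_eq_inter h, ← Finset.filter_mem_eq_inter, Finset.filter_insert,
    Finset.filter_singleton]
  split_ifs <;> simp [hne]

theorem card_separators_le_card_separators
    (h : ¬ (G.coloredGraph s).Reachable a b) (h' : ¬ (G.coloredGraph s').Reachable a b)
    (hactive : ∀ c, G.component s c ∈ G.activeSets t s → G.component s' c ∈ G.activeSets t' s') :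
    (G.separators t s a b).card ≤ (G.separators t' s' a b).card := by
  rw [card_separators h, card_separators h']
  gcongr ?_ + ?_ <;> split_ifs <;> simp_all

theorem separators_eq_empty_of_activeSets_eq_empty (h : G.activeSets t s = ∅) :
    G.separators t s a b = ∅ := by
  simp [separators, h]

theorem edgeWaits_union_vertexWaits_finite : (G.edgeWaits t s ∪ vertexWaits t s).Finite := by
  classical
  refine Set.Finite.union ?_ ?_
  · refine (Set.finite_range fun p : V × V => ((G.cost s(p.1, p.2) : ℝ) - s.colored p.1 p.2) /
      ((({G.component s p.1, G.component s p.2} : Finset (Finset V)) ∩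
        G.activeSets t s).card : ℝ)).subset ?_
    rintro δ ⟨a, b, -, -, -, h⟩
    exact ⟨(a, b), by rw [h]⟩
  · refine (Set.finite_range fun a => (t a : ℝ) - s.time).subset ?_
    rintro δ ⟨a, -, rfl⟩
    exact ⟨a, rfl⟩

theorem wait_le (h : δ ∈ G.edgeWaits t s ∪ vertexWaits t s) : G.wait t s ≤ δ :=
  csInf_le edgeWaits_union_vertexWaits_finite.bddBelow h

theorem wait_mem (h : (G.activeSets t s).Nonempty) :
    G.wait t s ∈ G.edgeWaits t s ∪ vertexWaits t s := by
  obtain ⟨S, hS⟩ := h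
  obtain ⟨-, a, -, ha⟩ := mem_activeSets.1 hS
  exact Set.Nonempty.csInf_mem ⟨_, Or.inr ⟨a, ha, rfl⟩⟩ edgeWaits_union_vertexWaits_finite

theorem wait_pos (h : (G.activeSets t s).Nonempty) : 0 < G.wait t s := by
  rcases wait_mem h with ⟨a, b, hadj, hne, hinter, hwait⟩ | ⟨a, ha, hwait⟩
  · rw [hwait]
    have hlt := colored_lt_cost hadj fun h' => hne (component_eq_iff.2 h')
    exact div_pos (sub_pos.2 hlt) (mod_cast hinter.card_pos)
  · rw [hwait]
    exact sub_pos.2 ha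

theorem wait_eq_zero (h : G.activeSets t s = ∅) : G.wait t s = 0 := by
  have hnone : G.edgeWaits t s ∪ vertexWaits t s = ∅ := by
    rw [Set.eq_empty_iff_forall_notMem]
    rintro δ (⟨a, b, -, -, hinter, -⟩ | ⟨a, ha, -⟩)
    · simp [h] at hinter
    · simpa [h] using component_mem_activeSets_of_lt (G := G) ha
  rw [wait, hnone, Real.sInf_empty]

theorem wait_nonneg : 0 ≤ G.wait t s := by
  rcases (G.activeSets t s).eq_empty_or_nonempty with h | h
  · exact (wait_eq_zero h).ge
  · exact (wait_pos h).le

theorem wait_mul_card_separators_le (hadj : G.graph.Adj a b)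
    (h : ¬ (G.coloredGraph s).Reachable a b) :
    G.wait t s * (G.separators t s a b).card ≤ G.cost s(a, b) - s.colored a b := by
  classical
  rcases (G.separators t s a b).eq_empty_or_nonempty with hempty | hnonempty
  · rw [hempty, Finset.card_empty, Nat.cast_zero, mul_zero]
    exact sub_nonneg.2 (colored_lt_cost hadj h).le
  · rw [← le_div_iff₀ (mod_cast hnonempty.card_pos)]
    rw [separators_eq_inter h] at hnonempty ⊢
    exact wait_le (Or.inl ⟨a, b, hadj, fun h' => h (component_eq_iff.1 h'), hnonempty, rfl⟩)

open scoped Classical in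
/-- The state after all active sets have grown for time `δ`, provided that no event intervenes. -/
noncomputable def advance (G : CostGraph V) (t : V → ℝ≥0) (s : State V) (δ : ℝ) : State V where
  time := s.time + δ
  growth S := s.growth S + if S ∈ G.activeSets t s then δ else 0

theorem colored_advance :
    (G.advance t s δ).colored a b = s.colored a b + δ * (G.separators t s a b).card := by
  classical
  unfold State.colored advance
  rw [Finset.sum_add_distrib, ← Finset.sum_filter, Finset.sum_const, nsmul_eq_mul, mul_comm δ]
  congr 4
  ext S
  simp only [separators, Finset.mem_filter, Finset.mem_univ, true_and, and_comm]

theorem colored_le_colored_advance (hδ : 0 ≤ δ) :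
    s.colored a b ≤ (G.advance t s δ).colored a b := by
  rw [colored_advance]
  exact le_add_of_nonneg_right (by positivity)

theorem colored_advance_le_cost (hδ : δ ≤ G.wait t s ∨ G.activeSets t s = ∅)
    (hadj : G.graph.Adj a b) (h : s.colored a b ≤ G.cost s(a, b)) :
    (G.advance t s δ).colored a b ≤ G.cost s(a, b) := by
  rw [colored_advance]
  rcases (G.separators t s a b).eq_empty_or_nonempty with hempty | hnonempty
  · rwa [hempty, Finset.card_empty, Nat.cast_zero, mul_zero, add_zero]
  · have hr : ¬ (G.coloredGraph s).Reachable a b := fun hr => by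
      simp [separators_eq_empty hr] at hnonempty
    have hle := wait_mul_card_separators_le (t := t) hadj hr
    have hδ' : δ ≤ G.wait t s := hδ.resolve_right fun hempty => by
      simp [separators_eq_empty_of_activeSets_eq_empty hempty] at hnonempty
    have := mul_le_mul_of_nonneg_right hδ' (Nat.cast_nonneg (α := ℝ) (G.separators t s a b).card)
    linarith

theorem reachable_advance_iff (h0 : 0 ≤ δ) (hδ : δ < G.wait t s ∨ G.activeSets t s = ∅) :
    (G.coloredGraph (G.advance t s δ)).Reachable a b ↔ (G.coloredGraph s).Reachable a b := by
  refine ⟨reachable_of_adj_reachable fun a b hab => ?_,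
    reachable_of_colored_le fun a b => colored_le_colored_advance h0⟩
  by_contra h
  have hlt := colored_lt_cost hab.1 h
  have hcost : (G.cost s(a, b) : ℝ) ≤ s.colored a b + δ * (G.separators t s a b).card :=
    hab.2.trans_eq colored_advance
  rcases (G.separators t s a b).card.eq_zero_or_pos with hcard | hcard
  · rw [hcard, Nat.cast_zero, mul_zero] at hcost
    linarith
  · have hlt' : δ < G.wait t s := hδ.resolve_right fun hempty => by
      simp [separators_eq_empty_of_activeSets_eq_empty hempty] at hcard
    have hle := wait_mul_card_separators_le (t := t) hab.1 h
    have := mul_lt_mul_of_pos_right hlt' (Nat.cast_pos (α := ℝ).2 hcard)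
    linarith

theorem component_advance (h0 : 0 ≤ δ) (hδ : δ < G.wait t s ∨ G.activeSets t s = ∅) (a : V) :
    G.component (G.advance t s δ) a = G.component s a := by
  ext b
  rw [mem_component, mem_component, reachable_advance_iff h0 hδ]

theorem components_advance (h0 : 0 ≤ δ) (hδ : δ < G.wait t s ∨ G.activeSets t s = ∅) :
    G.components (G.advance t s δ) = G.components s := by
  ext S
  simp only [mem_components, component_advance h0 hδ]

theorem time_advance_lt_iff (h0 : 0 ≤ δ) (hδ : δ < G.wait t s ∨ G.activeSets t s = ∅) :
    (G.advance t s δ).time < t a ↔ s.time < t a := by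
  change s.time + δ < t a ↔ _
  refine ⟨fun h => by linarith, fun h => ?_⟩
  have hlt : δ < G.wait t s := hδ.resolve_right fun hempty => by
    simpa [hempty] using component_mem_activeSets_of_lt (G := G) h
  have hle : G.wait t s ≤ t a - s.time := wait_le (Or.inr ⟨a, h, rfl⟩)
  linarith

theorem activeSets_advance (h0 : 0 ≤ δ) (hδ : δ < G.wait t s ∨ G.activeSets t s = ∅) :
    G.activeSets t (G.advance t s δ) = G.activeSets t s := by
  ext S
  simp only [mem_activeSets, components_advance h0 hδ, time_advance_lt_iff h0 hδ]

/-! ### The execution at arbitrary moments -/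

theorem run_succ :
    G.run t (n + 1) = G.advance t (G.run t n) (G.wait t (G.run t n)) := rfl

theorem run_succ_time :
    (G.run t (n + 1)).time = (G.run t n).time + G.wait t (G.run t n) := rfl

theorem run_eq_of_activeSets_eq_empty (hnm : n ≤ m) (h : G.activeSets t (G.run t n) = ∅) :
    G.run t m = G.run t n := by
  induction m, hnm using Nat.le_induction with
  | base => rfl
  | succ m _ ih => rw [run_succ, ih, wait_eq_zero h]; simp [advance]

theorem run_time_mono : Monotone fun n => (G.run t n).time :=
  monotone_nat_of_le_succ fun n => by
    rw [run_succ_time]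
    linarith [wait_nonneg (G := G) (t := t) (s := G.run t n)]

theorem run_time_nonneg : 0 ≤ (G.run t n).time :=
  run_time_mono (Nat.zero_le n)

theorem run_colored_le_cost (hadj : G.graph.Adj a b) :
    (G.run t n).colored a b ≤ G.cost s(a, b) := by
  induction n with
  | zero => simp [run, State.colored]
  | succ n ih => exact colored_advance_le_cost (Or.inl le_rfl) hadj ih

open scoped Classical in
/-- A termination measure for moat growing: the vertices whose growing time is over, together with
the pairs of vertices in a common component. -/
noncomputable def progress (G : CostGraph V) (t : V → ℝ≥0) (s : State V) : Finset (V ⊕ V × V) :=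
  {a | (t a : ℝ) ≤ s.time}.toFinset.disjSum
    {p : V × V | (G.coloredGraph s).Reachable p.1 p.2}.toFinset

theorem inl_mem_progress : Sum.inl a ∈ G.progress t s ↔ (t a : ℝ) ≤ s.time := by
  simp [progress]

theorem inr_mem_progress :
    Sum.inr (a, b) ∈ G.progress t s ↔ (G.coloredGraph s).Reachable a b := by
  simp [progress]

theorem progress_subset_advance (hδ : 0 ≤ δ) :
    G.progress t s ⊆ G.progress t (G.advance t s δ) := by
  rintro (a | ⟨a, b⟩) hx
  · exact inl_mem_progress.2 ((inl_mem_progress.1 hx).trans (le_add_of_nonneg_right hδ))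
  · exact inr_mem_progress.2
      (reachable_of_colored_le (fun _ _ => colored_le_colored_advance hδ) (inr_mem_progress.1 hx))

theorem progress_ssubset_advance_wait (h : (G.activeSets t s).Nonempty) :
    G.progress t s ⊂ G.progress t (G.advance t s (G.wait t s)) := by
  classical
  rw [Finset.ssubset_iff_of_subset (progress_subset_advance wait_nonneg)]
  rcases wait_mem h with ⟨a, b, hadj, hne, hinter, hwait⟩ | ⟨a, ha, hwait⟩
  · have hr : ¬ (G.coloredGraph s).Reachable a b := fun h' => hne (component_eq_iff.2 h')
    refine ⟨Sum.inr (a, b), inr_mem_progress.2 ?_, fun h' => hr (inr_mem_progress.1 h')⟩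
    refine SimpleGraph.Adj.reachable (adj_coloredGraph.2 ⟨hadj, ?_⟩)
    rw [colored_advance, separators_eq_inter hr, hwait,
      div_mul_cancel₀ _ (mod_cast hinter.card_pos.ne'), add_sub_cancel]
  · refine ⟨Sum.inl a, inl_mem_progress.2 ?_, fun h' => ha.not_ge (inl_mem_progress.1 h')⟩
    change (t a : ℝ) ≤ s.time + G.wait t s
    rw [hwait, add_sub_cancel]

variable (G t) in
theorem exists_activeSets_run_eq_empty : ∃ n, G.activeSets t (G.run t n) = ∅ := by
  by_contra! hactive
  have hcard : StrictMono fun n => (G.progress t (G.run t n)).card :=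
    strictMono_nat_of_lt_succ fun n =>
      Finset.card_lt_card (progress_ssubset_advance_wait (hactive n))
  obtain ⟨n, hn⟩ := hcard.tendsto_atTop.eventually_gt_atTop (Fintype.card (V ⊕ V × V)) |>.exists
  exact (Finset.card_le_univ _).not_gt hn

variable (G t) in
theorem exists_run_time_lt_le (hτ : 0 < τ) :
    ∃ n, (G.run t n).time < τ ∧ (τ ≤ (G.run t (n + 1)).time ∨ G.activeSets t (G.run t n) = ∅) := by
  by_cases h : ∃ n, τ ≤ (G.run t n).time
  · obtain ⟨n, hn, hn'⟩ :=
      Nat.exists_not_and_succ_of_not_zero_of_exists (p := fun n => τ ≤ (G.run t n).time)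
        hτ.not_ge h
    exact ⟨n, not_le.1 hn, Or.inl hn'⟩
  · obtain ⟨n, hn⟩ := exists_activeSets_run_eq_empty G t
    exact ⟨n, not_le.1 fun hle => h ⟨n, hle⟩, Or.inr hn⟩

variable (G t) in
theorem exists_inPhase (hτ : 0 ≤ τ) : ∃ n, G.InPhase t n τ := by
  by_cases h : ∃ n, τ < (G.run t n).time
  · obtain ⟨n, hn, hn'⟩ :=
      Nat.exists_not_and_succ_of_not_zero_of_exists (p := fun n => τ < (G.run t n).time)
        hτ.not_gt h
    exact ⟨n, not_lt.1 hn, Or.inl hn'⟩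
  · obtain ⟨n, hn⟩ := exists_activeSets_run_eq_empty G t
    exact ⟨n, not_lt.1 fun hlt => h ⟨n, hlt⟩, Or.inr hn⟩

theorem InPhase.nonneg (hn : G.InPhase t n τ) : 0 ≤ τ :=
  run_time_nonneg.trans hn.1

theorem InPhase.run_eq_of_le (hn : G.InPhase t n τ) (hm : G.InPhase t m τ) (hnm : n ≤ m) :
    G.run t m = G.run t n := by
  rcases hn.2 with hlt | hempty
  · have hmn : m ≤ n := by
      by_contra! hlt'
      exact (hlt.trans_le (run_time_mono (Nat.succ_le_of_lt hlt'))).not_ge hm.1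
    rw [hmn.antisymm hnm]
  · exact run_eq_of_activeSets_eq_empty hnm hempty

theorem InPhase.run_eq (hn : G.InPhase t n τ) (hm : G.InPhase t m τ) :
    G.run t n = G.run t m :=
  (le_total n m).elim (fun h => (hn.run_eq_of_le hm h).symm) (hm.run_eq_of_le hn)

theorem InPhase.growsAt_iff (hn : G.InPhase t n τ) :
    G.GrowsAt t τ S ↔ S ∈ G.activeSets t (G.run t n) :=
  ⟨fun ⟨_, hm, hS⟩ => hn.run_eq hm ▸ hS, fun hS => ⟨n, hn, hS⟩⟩

theorem InPhase.isComponentAt_iff (hn : G.InPhase t n τ) :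
    G.IsComponentAt t τ S ↔ S ∈ G.components (G.run t n) :=
  ⟨fun ⟨_, hm, hS⟩ => hn.run_eq hm ▸ hS, fun hS => ⟨n, hn, hS⟩⟩

theorem InPhase.eventually (hn : G.InPhase t n τ) : ∀ᶠ σ in 𝓝[≥] τ, G.InPhase t n σ := by
  rcases hn.2 with hlt | hempty
  · filter_upwards [self_mem_nhdsWithin, mem_nhdsWithin_of_mem_nhds (Iio_mem_nhds hlt)]
      with σ hτσ hσ
    exact ⟨hn.1.trans hτσ, Or.inl hσ⟩
  · filter_upwards [self_mem_nhdsWithin] with σ hτσ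
    exact ⟨hn.1.trans hτσ, Or.inr hempty⟩

theorem InPhase.sub_lt_wait (hn : G.InPhase t n τ) :
    τ - (G.run t n).time < G.wait t (G.run t n) ∨ G.activeSets t (G.run t n) = ∅ :=
  hn.2.imp_left fun h => by rw [run_succ_time] at h; linarith

theorem GrowsAt.nonneg (h : G.GrowsAt t τ S) : 0 ≤ τ :=
  let ⟨_, hn, _⟩ := h
  hn.nonneg

theorem GrowsAt.exists_lt (h : G.GrowsAt t τ S) : ∃ a ∈ S, τ < t a := by
  obtain ⟨n, hn, hS⟩ := h
  obtain ⟨-, a, haS, ha⟩ := mem_activeSets.1 hS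
  have hlt : τ - (G.run t n).time < G.wait t (G.run t n) :=
    hn.sub_lt_wait.resolve_right (Finset.ne_empty_of_mem hS)
  have hle : G.wait t (G.run t n) ≤ t a - (G.run t n).time := wait_le (Or.inr ⟨a, ha, rfl⟩)
  exact ⟨a, haS, by linarith⟩

variable (G t S) in
theorem setOf_growsAt :
    {τ | G.GrowsAt t τ S} =
      ⋃ n ∈ {n | S ∈ G.activeSets t (G.run t n)},
        Set.Ico (G.run t n).time (G.run t (n + 1)).time := by
  ext τ
  simp only [Set.mem_ofPred_eq, Set.mem_iUnion, Set.mem_Ico, exists_prop, GrowsAt, InPhase]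
  refine exists_congr fun n => ?_
  have := fun hS : S ∈ G.activeSets t (G.run t n) => Finset.ne_empty_of_mem hS
  tauto

variable (G t S) in
theorem measurableSet_growsAt : MeasurableSet {τ | G.GrowsAt t τ S} := by
  rw [setOf_growsAt]
  exact .biUnion (Set.to_countable _) fun _ _ => measurableSet_Ico

theorem setOf_growsAt_subset_Ico : {τ | G.GrowsAt t τ S} ⊆ Set.Ico 0 (∑ a, (t a : ℝ)) := by
  intro τ hτ
  obtain ⟨a, -, ha⟩ := hτ.exists_lt
  exact ⟨hτ.nonneg, ha.trans_le
    (Finset.single_le_sum (f := fun a => (t a : ℝ)) (fun _ _ => NNReal.coe_nonneg _)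
      (Finset.mem_univ a))⟩

variable (G t S) in
theorem volume_growsAt_ne_top : volume {τ | G.GrowsAt t τ S} ≠ ⊤ :=
  measure_ne_top_of_subset setOf_growsAt_subset_Ico measure_Ico_lt_top.ne

/-- The state of moat growing at an arbitrary moment `τ ≥ 0`, not necessarily that of an event. It
is read off from `GrowsAt`, which determines the execution. -/
noncomputable def stateAt (G : CostGraph V) (t : V → ℝ≥0) (τ : ℝ) : State V where
  time := τ
  growth S := volume.real {x | G.GrowsAt t x S ∧ x < τ}

theorem growth_stateAt_ne_top : volume {x | G.GrowsAt t x S ∧ x < τ} ≠ ⊤ :=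
  measure_ne_top_of_subset (fun _ hx => hx.1) (volume_growsAt_ne_top G t S)

theorem growth_stateAt_mono : Monotone fun τ => (G.stateAt t τ).growth S := fun _ _ h =>
  measureReal_mono (fun _ hx => ⟨hx.1, hx.2.trans_le h⟩) growth_stateAt_ne_top

theorem colored_stateAt_mono : Monotone fun τ => (G.stateAt t τ).colored a b := fun _ _ h =>
  Finset.sum_le_sum fun _ _ => growth_stateAt_mono h

open scoped Classical in
theorem growth_stateAt_eq_add (hn : (G.run t n).time ≤ τ)
    (hτ : τ ≤ (G.run t (n + 1)).time ∨ G.activeSets t (G.run t n) = ∅) :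
    (G.stateAt t τ).growth S = (G.stateAt t (G.run t n).time).growth S +
      if S ∈ G.activeSets t (G.run t n) then τ - (G.run t n).time else 0 := by
  have hgrows : ∀ x ∈ Set.Ico (G.run t n).time τ,
      (G.GrowsAt t x S ↔ S ∈ G.activeSets t (G.run t n)) := fun x hx =>
    InPhase.growsAt_iff ⟨hx.1, hτ.imp_left hx.2.trans_le⟩
  simp only [Set.mem_Ico] at hgrows
  split_ifs with hS
  · have hunion : {x | G.GrowsAt t x S ∧ x < τ} =
        {x | G.GrowsAt t x S ∧ x < (G.run t n).time} ∪ Set.Ico (G.run t n).time τ := by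
      ext x
      simp only [Set.mem_ofPred_eq, Set.mem_union, Set.mem_Ico]
      grind
    have hdisj : Disjoint {x | G.GrowsAt t x S ∧ x < (G.run t n).time}
        (Set.Ico (G.run t n).time τ) :=
      Set.disjoint_left.2 fun x hx hx' => hx.2.not_ge hx'.1
    simp only [stateAt]
    rw [hunion, measureReal_union hdisj measurableSet_Ico growth_stateAt_ne_top
      measure_Ico_lt_top.ne, Real.volume_real_Ico_of_le hn]
  · simp only [stateAt, add_zero]
    congr 1
    ext x
    simp only [Set.mem_ofPred_eq]
    grind

theorem run_eq_stateAt : G.run t n = G.stateAt t (G.run t n).time := by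
  induction n with
  | zero =>
    have hnone (S : Finset V) : {x | G.GrowsAt t x S ∧ x < 0} = ∅ :=
      Set.eq_empty_of_forall_notMem fun x hx => hx.2.not_ge hx.1.nonneg
    simp [run, stateAt, hnone]
  | succ n ih =>
    have htime : (G.run t n).time ≤ (G.run t (n + 1)).time := run_time_mono n.le_succ
    refine congrArg₂ State.mk rfl (funext fun S => .trans ?_
      (growth_stateAt_eq_add htime (Or.inl le_rfl)).symm)
    rw [← ih, run_succ_time, add_sub_cancel_left]

theorem stateAt_eq_advance (hn : (G.run t n).time ≤ τ)
    (hτ : τ ≤ (G.run t (n + 1)).time ∨ G.activeSets t (G.run t n) = ∅) :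
    G.stateAt t τ = G.advance t (G.run t n) (τ - (G.run t n).time) := by
  refine congrArg₂ State.mk (add_sub_cancel _ _).symm
    (funext fun S => (growth_stateAt_eq_add hn hτ).trans ?_)
  rw [← run_eq_stateAt]

theorem InPhase.stateAt_eq_advance (hn : G.InPhase t n τ) :
    G.stateAt t τ = G.advance t (G.run t n) (τ - (G.run t n).time) :=
  CostGraph.stateAt_eq_advance hn.1 (hn.2.imp_left le_of_lt)

theorem InPhase.component_stateAt (hn : G.InPhase t n τ) (a : V) :
    G.component (G.stateAt t τ) a = G.component (G.run t n) a := by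
  rw [hn.stateAt_eq_advance, component_advance (sub_nonneg.2 hn.1) hn.sub_lt_wait]

theorem isComponentAt_iff (hτ : 0 ≤ τ) :
    G.IsComponentAt t τ S ↔ S ∈ G.components (G.stateAt t τ) := by
  obtain ⟨n, hn⟩ := exists_inPhase G t hτ
  rw [hn.isComponentAt_iff, hn.stateAt_eq_advance,
    components_advance (sub_nonneg.2 hn.1) hn.sub_lt_wait]

theorem growsAt_iff (hτ : 0 ≤ τ) :
    G.GrowsAt t τ S ↔ S ∈ G.activeSets t (G.stateAt t τ) := by
  obtain ⟨n, hn⟩ := exists_inPhase G t hτ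
  rw [hn.growsAt_iff, hn.stateAt_eq_advance,
    activeSets_advance (sub_nonneg.2 hn.1) hn.sub_lt_wait]

theorem colored_stateAt_le_cost (hτ : 0 ≤ τ) (hadj : G.graph.Adj a b) :
    (G.stateAt t τ).colored a b ≤ G.cost s(a, b) := by
  obtain ⟨n, hn⟩ := exists_inPhase G t hτ
  rw [hn.stateAt_eq_advance]
  exact colored_advance_le_cost (hn.sub_lt_wait.imp_left le_of_lt) hadj (run_colored_le_cost hadj)

variable (G t) in
theorem eventually_component_stateAt_eq (hτ : 0 ≤ τ) :
    ∀ᶠ σ in 𝓝[≥] τ, ∀ a, G.component (G.stateAt t σ) a = G.component (G.stateAt t τ) a := by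
  obtain ⟨n, hn⟩ := exists_inPhase G t hτ
  filter_upwards [hn.eventually] with σ hσ a
  rw [hσ.component_stateAt, hn.component_stateAt]

open scoped Classical in
theorem indicator_growsAt (hτ : 0 ≤ τ) :
    Set.indicator {x | G.GrowsAt t x S} (1 : ℝ → ℝ) τ =
      if S ∈ G.activeSets t (G.stateAt t τ) then 1 else 0 := by
  simp [Set.indicator_apply, growsAt_iff hτ]

theorem integrable_indicator_one_of_growsAt {B : Set ℝ} (hB : MeasurableSet B)
    (hsub : ∀ τ ∈ B, G.GrowsAt t τ S) : Integrable (B.indicator (1 : ℝ → ℝ)) :=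
  (integrable_indicator_iff hB).2
    (integrableOn_const (measure_ne_top_of_subset hsub (volume_growsAt_ne_top G t S)))

theorem integrable_indicator_growsAt :
    Integrable (Set.indicator {x | G.GrowsAt t x S} (1 : ℝ → ℝ)) :=
  integrable_indicator_one_of_growsAt (measurableSet_growsAt G t S) fun _ h => h

open scoped Classical in
theorem card_separators_stateAt (hτ : 0 ≤ τ) :
    ((G.separators t (G.stateAt t τ) a b).card : ℝ) =
      ∑ S : Finset V with (a ∈ S ↔ b ∉ S), Set.indicator {x | G.GrowsAt t x S} 1 τ := by
  simp only [indicator_growsAt hτ, Finset.sum_boole, Finset.filter_filter]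
  congr 2
  ext S
  simp [separators, and_comm]

theorem integrableOn_card_separators_stateAt :
    IntegrableOn (fun x => ((G.separators t (G.stateAt t x) a b).card : ℝ)) (Set.Ico 0 τ) := by
  classical
  refine IntegrableOn.congr_fun
    (f := fun x => ∑ S : Finset V with (a ∈ S ↔ b ∉ S), Set.indicator {x | G.GrowsAt t x S} 1 x)
    ?_ (fun x hx => (card_separators_stateAt hx.1).symm) measurableSet_Ico
  exact integrable_finsetSum _ fun S _ => integrable_indicator_growsAt.integrableOn

theorem colored_stateAt_eq_integral : (G.stateAt t τ).colored a b =
    ∫ x in Set.Ico 0 τ, ((G.separators t (G.stateAt t x) a b).card : ℝ) := by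
  classical
  rw [setIntegral_congr_fun measurableSet_Ico fun x hx => card_separators_stateAt hx.1,
    integral_finsetSum _ fun S _ => integrable_indicator_growsAt.integrableOn]
  refine Finset.sum_congr rfl fun S _ => ?_
  rw [setIntegral_indicator (measurableSet_growsAt G t S), Pi.one_def, setIntegral_const,
    smul_eq_mul, mul_one]
  refine congrArg volume.real (Set.ext fun x => ?_)
  exact ⟨fun hx => ⟨⟨hx.1.nonneg, hx.2⟩, hx.1⟩, fun hx => ⟨hx.2, hx.1.2⟩⟩

/-- The vertices `a` and `b` lie in the same component at the moment `τ`. -/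
def Joined (G : CostGraph V) (t : V → ℝ≥0) (τ : ℝ) (a b : V) : Prop :=
  (G.coloredGraph (G.stateAt t τ)).Reachable a b

theorem joined_iff_component_eq :
    G.Joined t τ a b ↔ G.component (G.stateAt t τ) a = G.component (G.stateAt t τ) b :=
  component_eq_iff.symm

theorem Joined.comm : G.Joined t τ a b ↔ G.Joined t τ b a :=
  SimpleGraph.reachable_comm

theorem Joined.mono (hτσ : τ ≤ σ) (h : G.Joined t τ a b) : G.Joined t σ a b :=
  reachable_of_colored_le (fun _ _ => colored_stateAt_mono hτσ) h

variable (G t) in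
theorem eventually_joined_iff (hτ : 0 ≤ τ) :
    ∀ᶠ σ in 𝓝[≥] τ, ∀ a b, G.Joined t σ a b ↔ G.Joined t τ a b := by
  filter_upwards [eventually_component_stateAt_eq G t hτ] with σ hσ a b
  rw [joined_iff_component_eq, joined_iff_component_eq, hσ, hσ]

/-- The component of `a` is active and growing immediately after the moment `τ`. -/
def VertexGrowsAt (G : CostGraph V) (t : V → ℝ≥0) (τ : ℝ) (a : V) : Prop :=
  G.component (G.stateAt t τ) a ∈ G.activeSets t (G.stateAt t τ)

theorem vertexGrowsAt_iff_exists_joined :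
    G.VertexGrowsAt t τ a ↔ ∃ b, G.Joined t τ a b ∧ τ < t b :=
  component_mem_activeSets

theorem vertexGrowsAt_iff_exists_growsAt (hτ : 0 ≤ τ) :
    G.VertexGrowsAt t τ a ↔ ∃ S, G.GrowsAt t τ S ∧ a ∈ S := by
  refine ⟨fun h => ⟨_, (growsAt_iff hτ).2 h, self_mem_component⟩, fun ⟨S, hS, ha⟩ => ?_⟩
  rw [growsAt_iff hτ] at hS
  rwa [VertexGrowsAt, component_eq_of_mem (mem_activeSets.1 hS).1 ha]

theorem vertexGrowsAt_of_lt (h : τ < t a) : G.VertexGrowsAt t τ a :=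
  component_mem_activeSets_of_lt h

theorem Joined.vertexGrowsAt_iff (h : G.Joined t τ a b) :
    G.VertexGrowsAt t τ a ↔ G.VertexGrowsAt t τ b := by
  rw [VertexGrowsAt, VertexGrowsAt, joined_iff_component_eq.1 h]

/-! ### Comparison of executions -/

theorem colored_stateAt_le_of_separators
    (h : ∀ x ∈ Set.Ico 0 τ, (G.separators t₁ (G.stateAt t₁ x) a b).card ≤
      (G.separators t₂ (G.stateAt t₂ x) a b).card) :
    (G.stateAt t₁ τ).colored a b ≤ (G.stateAt t₂ τ).colored a b := by
  rw [colored_stateAt_eq_integral, colored_stateAt_eq_integral]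
  exact setIntegral_mono_on integrableOn_card_separators_stateAt
    integrableOn_card_separators_stateAt measurableSet_Ico fun x hx => Nat.cast_le.2 (h x hx)

/-- As long as `a` and `b` are not joined in the second execution, the edge `ab` is coloured there
at least as fast as in the first one. -/
theorem Joined.of_forall_lt
    (hjoined : ∀ x ∈ Set.Ico 0 τ, ∀ a b, G.Joined t₁ x a b → G.Joined t₂ x a b)
    (hgrows : ∀ x ∈ Set.Ico 0 τ, ∀ a, x < t₁ a → G.VertexGrowsAt t₂ x a)
    (h : G.Joined t₁ τ a b) : G.Joined t₂ τ a b := by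
  refine reachable_of_adj_reachable (fun a b hadj => ?_) h
  by_contra hnot
  have hnot' : ∀ x ∈ Set.Ico 0 τ, ¬ G.Joined t₂ x a b := fun x hx hx' => hnot (hx'.mono hx.2.le)
  have hle : (G.stateAt t₁ τ).colored a b ≤ (G.stateAt t₂ τ).colored a b := by
    refine colored_stateAt_le_of_separators fun x hx => card_separators_le_card_separators
      (fun hx' => hnot' x hx (hjoined x hx a b hx')) (hnot' x hx) fun c hc => ?_
    obtain ⟨d, hcd, hd⟩ := vertexGrowsAt_iff_exists_joined.1 hc
    exact (hjoined x hx c d hcd).vertexGrowsAt_iff.2 (hgrows x hx d hd)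
  exact (hle.trans_lt (colored_lt_cost hadj.1 hnot)).not_ge hadj.2

theorem Joined.of_vertexGrowsAt (hgrows : ∀ x ∈ Set.Ico 0 M, ∀ a, x < t₁ a → G.VertexGrowsAt t₂ x a)
    (hτ : 0 ≤ τ) (hτM : τ ≤ M) (h : G.Joined t₁ τ a b) : G.Joined t₂ τ a b := by
  suffices key : ∀ τ ≥ 0, τ ≤ M → ∀ a b, G.Joined t₁ τ a b → G.Joined t₂ τ a b from
    key τ hτ hτM a b h
  refine forall_ge_of_eventually_nhdsGE (fun τ _ hlt hτM a b => ?_) fun τ hτ hjoined => ?_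
  · exact Joined.of_forall_lt (fun x hx => hlt x hx.1 hx.2 (hx.2.le.trans hτM))
      fun x hx => hgrows x ⟨hx.1, hx.2.trans_le hτM⟩
  · filter_upwards [eventually_joined_iff G t₁ hτ, self_mem_nhdsWithin]
      with σ hσ (hτσ : τ ≤ σ) hσM a b hab
    exact (hjoined (hτσ.trans hσM) a b ((hσ a b).1 hab)).mono hτσ

theorem Joined.mono_fingerprint (ht : t₁ ≤ t₂) (hτ : 0 ≤ τ) (h : G.Joined t₁ τ a b) :
    G.Joined t₂ τ a b :=
  Joined.of_vertexGrowsAt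
    (fun _ _ a ha => vertexGrowsAt_of_lt (ha.trans_le (NNReal.coe_le_coe.2 (ht a)))) hτ le_rfl h

theorem VertexGrowsAt.mono_fingerprint (ht : t₁ ≤ t₂) (hτ : 0 ≤ τ) (h : G.VertexGrowsAt t₁ τ a) :
    G.VertexGrowsAt t₂ τ a := by
  obtain ⟨b, hab, hb⟩ := vertexGrowsAt_iff_exists_joined.1 h
  exact vertexGrowsAt_iff_exists_joined.2
    ⟨b, hab.mono_fingerprint ht hτ, hb.trans_le (NNReal.coe_le_coe.2 (ht b))⟩

theorem exists_first_joined (a b : V) (hM : 0 ≤ M) :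
    ∃ ρ ≥ 0, ρ ≤ M ∧ ∀ τ ∈ Set.Ico 0 M, G.Joined t τ a b ↔ ρ ≤ τ := by
  obtain ⟨ρ, ⟨hρ0, hρ⟩, hleast⟩ := exists_isLeast_of_frequently_nhdsGE
    (B := {τ | 0 ≤ τ ∧ (G.Joined t τ a b ∨ M ≤ τ)}) ⟨M, hM, Or.inr le_rfl⟩
    (fun _ hτ => hτ.1) fun τ hτ hfreq => by
      refine ⟨hτ, or_iff_not_imp_right.2 fun hτM => ?_⟩
      obtain ⟨σ, hσ, hjoined, hσM⟩ := (hfreq.and_eventually ((eventually_joined_iff G t hτ).and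
        (eventually_nhdsWithin_of_eventually_nhds (eventually_lt_nhds (not_le.1 hτM))))).exists
      exact (hjoined a b).1 (hσ.2.resolve_right hσM.not_ge)
  refine ⟨ρ, hρ0, hleast ⟨hM, Or.inr le_rfl⟩, fun τ hτ => ⟨fun h => hleast ⟨hτ.1, Or.inl h⟩, ?_⟩⟩
  exact fun hρτ => (hρ.resolve_right (hρτ.trans_lt hτ.2).not_ge).mono hρτ

/-! ### Distances -/

theorem State.colored_self : s.colored a a = 0 := by
  classical
  refine Finset.sum_eq_zero fun S hS => ?_
  have := (Finset.mem_filter.1 hS).2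
  tauto

theorem State.colored_triangle {c : V} (hs : ∀ S, 0 ≤ s.growth S) :
    s.colored a c ≤ s.colored a b + s.colored b c := by
  classical
  unfold State.colored
  rw [Finset.sum_filter, Finset.sum_filter, Finset.sum_filter, ← Finset.sum_add_distrib]
  refine Finset.sum_le_sum fun S _ => ?_
  have := hs S
  by_cases ha : a ∈ S <;> by_cases hb : b ∈ S <;> by_cases hc : c ∈ S <;> simp [ha, hb, hc, this]

theorem colored_stateAt_le_walkCost (hτ : 0 ≤ τ) (p : G.graph.Walk a b) :
    (G.stateAt t τ).colored a b ≤ G.walkCost p := by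
  induction p with
  | nil => simp [State.colored_self]
  | @cons a b c hadj p ih =>
    calc (G.stateAt t τ).colored a c
      _ ≤ (G.stateAt t τ).colored a b + (G.stateAt t τ).colored b c :=
        State.colored_triangle fun _ => measureReal_nonneg
      _ ≤ G.cost s(a, b) + G.walkCost p := add_le_add (colored_stateAt_le_cost hτ hadj) ih
      _ = G.walkCost (.cons hadj p) := by simp [walkCost]

theorem ofReal_colored_stateAt_le_dist (hτ : 0 ≤ τ) :
    ENNReal.ofReal ((G.stateAt t τ).colored a b) ≤ G.dist a b :=
  le_iInf fun p => by
    rw [← ENNReal.ofReal_coe_nnreal]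
    exact ENNReal.ofReal_le_ofReal (colored_stateAt_le_walkCost hτ p)

theorem colored_stateAt_eq_two_mul {r : ℝ} (hr : 0 ≤ r)
    (hjoined : ∀ τ ∈ Set.Ico 0 r, ¬ G.Joined t τ a b)
    (ha : ∀ τ ∈ Set.Ico 0 r, G.VertexGrowsAt t τ a)
    (hb : ∀ τ ∈ Set.Ico 0 r, G.VertexGrowsAt t τ b) : (G.stateAt t r).colored a b = 2 * r := by
  unfold VertexGrowsAt at ha hb
  have hcard : ∀ τ ∈ Set.Ico 0 r, ((G.separators t (G.stateAt t τ) a b).card : ℝ) = 2 :=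
    fun τ hτ => by
      rw [card_separators (hjoined τ hτ), if_pos (ha τ hτ), if_pos (hb τ hτ)]
      norm_num
  rw [colored_stateAt_eq_integral, setIntegral_congr_fun measurableSet_Ico hcard,
    setIntegral_const, Real.volume_real_Ico_of_le hr, sub_zero, smul_eq_mul, mul_comm]

theorem ofReal_le_dist_div_two {r : ℝ} (hr : 0 ≤ r)
    (hjoined : ∀ τ ∈ Set.Ico 0 r, ¬ G.Joined t τ a b)
    (ha : ∀ τ ∈ Set.Ico 0 r, G.VertexGrowsAt t τ a)
    (hb : ∀ τ ∈ Set.Ico 0 r, G.VertexGrowsAt t τ b) : ENNReal.ofReal r ≤ G.dist a b / 2 := by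
  rw [ENNReal.le_div_iff_mul_le (by simp) (by simp), ← ENNReal.ofReal_ofNat 2,
    ← ENNReal.ofReal_mul hr, mul_comm, ← colored_stateAt_eq_two_mul hr hjoined ha hb]
  exact ofReal_colored_stateAt_le_dist hr

theorem exists_growsUntil_of_first_joined (hσ : 0 < σ)
    (hlt : ∀ τ ∈ Set.Ico 0 σ, ¬ G.Joined t τ a b) (ha : ∀ τ ∈ Set.Ico 0 σ, G.VertexGrowsAt t τ a)
    (hb : ∀ τ ∈ Set.Ico 0 σ, G.VertexGrowsAt t τ b) (hjoined : G.Joined t σ a b) :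
    ∃ S S' C : Finset V, a ∈ S ∧ S ≠ S' ∧ G.GrowsUntil t σ S ∧ G.GrowsUntil t σ S' ∧
      G.IsComponentAt t σ C ∧ S ⊆ C ∧ S' ⊆ C := by
  obtain ⟨n, hn, hn'⟩ := exists_run_time_lt_le G t hσ
  have hmem : (G.run t n).time ∈ Set.Ico 0 σ := ⟨run_time_nonneg, hn⟩
  have hactive : ∀ c, G.VertexGrowsAt t (G.run t n).time c →
      G.component (G.run t n) c ∈ G.activeSets t (G.run t n) := fun c hc => by
    rwa [VertexGrowsAt, ← run_eq_stateAt] at hc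
  have hle : σ ≤ (G.run t (n + 1)).time :=
    hn'.resolve_right (Finset.ne_empty_of_mem (hactive a (ha _ hmem)))
  have hsub : ∀ c, G.component (G.run t n) c ⊆ G.component (G.stateAt t σ) c := fun c d hd => by
    rw [mem_component, run_eq_stateAt] at hd
    exact mem_component.2 (Joined.mono hn.le hd)
  refine ⟨G.component (G.run t n) a, G.component (G.run t n) b, G.component (G.stateAt t σ) a,
    self_mem_component, fun h => hlt _ hmem ?_, ⟨n, hn, hle, hactive a (ha _ hmem)⟩,
    ⟨n, hn, hle, hactive b (hb _ hmem)⟩, (isComponentAt_iff hσ.le).2 (mem_components.2 ⟨a, rfl⟩),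
    hsub a, joined_iff_component_eq.1 hjoined ▸ hsub b⟩
  rwa [component_eq_iff, run_eq_stateAt] at h

/-! ### Weighted growth -/

variable {ι : Type*} [Fintype ι] {x : ι → V} {ρ : ι → ℝ}

open scoped Classical in
/-- The rate of the weighted growth, in the execution with fingerprint `t'`, at the moment `τ`. -/
noncomputable def weightedRate (G : CostGraph V) (t : V → ℝ≥0) (β : ℝ) (t' : V → ℝ≥0) (τ : ℝ) : ℝ :=
  ∑ S : Finset V with G.GrowsAt t' τ S, weight t β τ S

theorem weightedRate_of_neg (hτ : τ < 0) : G.weightedRate t β t' τ = 0 := by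
  classical
  rw [weightedRate, Finset.filter_false_of_mem fun S _ hS => hτ.not_ge hS.nonneg, Finset.sum_empty]

theorem weightedRate_eq_sum_activeSets (hτ : 0 ≤ τ) :
    G.weightedRate t β t' τ = ∑ S ∈ G.activeSets t' (G.stateAt t' τ), weight t β τ S := by
  classical
  refine Finset.sum_congr (Finset.ext fun S => ?_) fun _ _ => rfl
  simp only [Finset.mem_filter, Finset.mem_univ, true_and, growsAt_iff hτ]

theorem weightedRate_eq_sum_indicator : G.weightedRate t β t' τ =
    ∑ S : Finset V, (Set.indicator {τ : ℝ | G.GrowsAt t' τ S ∧ ∃ a ∈ S, τ < t a} 1 τ +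
      (1 + β) * Set.indicator {τ : ℝ | G.GrowsAt t' τ S ∧ ∀ a ∈ S, t a ≤ τ} 1 τ) := by
  classical
  rw [weightedRate, Finset.sum_filter]
  refine Finset.sum_congr rfl fun S _ => ?_
  have hnot : (∀ a ∈ S, (t a : ℝ) ≤ τ) ↔ ¬ ∃ a ∈ S, τ < t a := by push Not; rfl
  simp only [weight, Set.indicator_apply, Set.mem_ofPred_eq, hnot, Pi.one_apply]
  split_ifs <;> simp_all

variable (G t S) in
theorem measurableSet_growsAt_base (t' : V → ℝ≥0) :
    MeasurableSet {τ : ℝ | G.GrowsAt t' τ S ∧ ∃ a ∈ S, τ < t a} :=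
  (measurableSet_growsAt G t' S).inter (measurableSet_exists_lt t S)

variable (G t S) in
theorem measurableSet_growsAt_additional (t' : V → ℝ≥0) :
    MeasurableSet {τ : ℝ | G.GrowsAt t' τ S ∧ ∀ a ∈ S, t a ≤ τ} := by
  have hinter : {τ : ℝ | G.GrowsAt t' τ S ∧ ∀ a ∈ S, t a ≤ τ} =
      {τ | G.GrowsAt t' τ S} ∩ {τ : ℝ | ∃ a ∈ S, τ < t a}ᶜ := by ext; simp
  rw [hinter]
  exact (measurableSet_growsAt G t' S).inter (measurableSet_exists_lt t S).compl

theorem integrable_weightedRate_summand : Integrable fun τ : ℝ =>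
    (Set.indicator {τ : ℝ | G.GrowsAt t' τ S ∧ ∃ a ∈ S, τ < t a} 1 τ +
      (1 + β) * Set.indicator {τ : ℝ | G.GrowsAt t' τ S ∧ ∀ a ∈ S, t a ≤ τ} 1 τ) :=
  (integrable_indicator_one_of_growsAt (measurableSet_growsAt_base G t S t') fun _ h => h.1).add
    ((integrable_indicator_one_of_growsAt (measurableSet_growsAt_additional G t S t')
      fun _ h => h.1).const_mul _)

theorem integrable_weightedRate : Integrable (G.weightedRate t β t') := by
  have hsum : G.weightedRate t β t' = _ := funext fun _ => weightedRate_eq_sum_indicator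
  rw [hsum]
  exact integrable_finsetSum _ fun S _ => integrable_weightedRate_summand

theorem integral_weightedRate :
    ∫ τ, G.weightedRate t β t' τ = G.yBase t t' + (1 + β) * G.yAdd t t' := by
  simp only [weightedRate_eq_sum_indicator]
  rw [integral_finsetSum _ fun S _ => integrable_weightedRate_summand, yBase, yAdd,
    Finset.mul_sum, ← Finset.sum_add_distrib]
  refine Finset.sum_congr rfl fun S _ => ?_
  rw [integral_add
      (integrable_indicator_one_of_growsAt (measurableSet_growsAt_base G t S t') fun _ h => h.1)
      ((integrable_indicator_one_of_growsAt (measurableSet_growsAt_additional G t S t')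
        fun _ h => h.1).const_mul _),
    integral_const_mul, integral_indicator_one (measurableSet_growsAt_base G t S t'),
    integral_indicator_one (measurableSet_growsAt_additional G t S t')]

theorem isValuable_iff_integral_weightedRate_le {σ : ℝ≥0} :
    G.IsValuable t β t' q σ ↔
      ∫ τ, G.weightedRate t β (boost t' q σ) τ ≤ ∫ τ, G.weightedRate t β t' τ := by
  rw [integral_weightedRate, integral_weightedRate, IsValuable, win, loss]
  constructor <;> intro h <;> linarith

open scoped Classical in
/-- The number of components, at the moment `τ`, that contain one of the vertices `x i`. -/
noncomputable def numComponents (G : CostGraph V) (t : V → ℝ≥0) (x : ι → V) (τ : ℝ) : ℕ :=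
  (Finset.univ.image fun i => G.component (G.stateAt t τ) (x i)).card

theorem biUnion_component_component [DecidableEq V]
    (h : ∀ a b, (G.coloredGraph s).Reachable a b → (G.coloredGraph s').Reachable a b) :
    (G.component s a).biUnion (G.component s') = G.component s' a := by
  ext b
  simp only [Finset.mem_biUnion, mem_component]
  exact ⟨fun ⟨c, hac, hcb⟩ => (h a c hac).trans hcb, fun hab => ⟨a, .rfl, hab⟩⟩

theorem subset_biUnion_component [DecidableEq V] : S ⊆ S.biUnion (G.component s) :=
  fun _ ha => Finset.mem_biUnion.2 ⟨_, ha, self_mem_component⟩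

open scoped Classical in
theorem activeSets_subset_image_union
    (hjoined : ∀ a b, G.Joined t₁ τ a b → G.Joined t₂ τ a b)
    (ht : ∀ a ≠ q, τ < t₂ a → τ < t₁ a) :
    G.activeSets t₂ (G.stateAt t₂ τ) ⊆
      (G.activeSets t₁ (G.stateAt t₁ τ)).image
        (fun S => S.biUnion (G.component (G.stateAt t₂ τ))) ∪
      if τ < t₂ q then {G.component (G.stateAt t₂ τ) q} else ∅ := by
  intro C hC
  obtain ⟨hC, b, hbC, hb⟩ := mem_activeSets.1 hC
  rw [← component_eq_of_mem hC hbC, Finset.mem_union]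
  obtain rfl | hbq := eq_or_ne b q
  · exact .inr ((if_pos hb).symm ▸ Finset.mem_singleton_self _)
  · exact .inl (Finset.mem_image.2 ⟨_, component_mem_activeSets_of_lt (ht b hbq hb),
      biUnion_component_component hjoined⟩)

/-- Merging never increases the weight, and the sets of the `x i` that merge lose at least `1`
each. -/
theorem weightedRate_add_numComponents_le (hβ : 0 ≤ β) (hτ : 0 ≤ τ)
    (hjoined : ∀ a b, G.Joined t₁ τ a b → G.Joined t₂ τ a b)
    (ht : ∀ a ≠ q, τ < t₂ a → τ < t₁ a) (hx : ∀ i, G.VertexGrowsAt t₁ τ (x i)) :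
    G.weightedRate t β t₂ τ + G.numComponents t₁ x τ ≤
      G.weightedRate t β t₁ τ + G.numComponents t₂ x τ + if τ < t₂ q then 1 + β else 0 := by
  classical
  have hmerge := sum_image_add_card_le (w := weight t β τ)
    (A := G.activeSets t₁ (G.stateAt t₁ τ))
    (f := fun S => S.biUnion (G.component (G.stateAt t₂ τ)))
    (X := Finset.univ.image fun i => G.component (G.stateAt t₁ τ) (x i))
    (fun _ => one_le_weight hβ) (fun _ => weight_anti hβ subset_biUnion_component)
    (Finset.image_subset_iff.2 fun i _ => hx i)
  rw [Finset.image_image, Function.comp_def] at hmerge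
  simp only [biUnion_component_component hjoined] at hmerge
  have hq : ∑ S ∈ (if τ < t₂ q then {G.component (G.stateAt t₂ τ) q} else ∅), weight t β τ S ≤
      if τ < t₂ q then 1 + β else 0 := by
    split_ifs
    · exact (Finset.sum_singleton _ _).trans_le (weight_le hβ)
    · exact Finset.sum_empty.le
  have hweight : ∀ S, 0 ≤ weight t β τ S := fun _ => zero_le_one.trans (one_le_weight hβ)
  have hunion := (Finset.sum_le_sum_of_subset_of_nonneg (activeSets_subset_image_union hjoined ht)
    fun S _ _ => hweight S).trans (sum_union_le hweight)
  rw [weightedRate_eq_sum_activeSets hτ, weightedRate_eq_sum_activeSets hτ]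
  unfold numComponents
  linarith

theorem numComponents_antitone : Antitone (G.numComponents t x) := fun τ σ h => by
  classical
  have himage : (Finset.univ.image fun i => G.component (G.stateAt t σ) (x i)) =
      (Finset.univ.image fun i => G.component (G.stateAt t τ) (x i)).image
        fun S => S.biUnion (G.component (G.stateAt t σ)) := by
    rw [Finset.image_image, Function.comp_def]
    simp only [biUnion_component_component fun a b (hab : G.Joined t τ a b) => hab.mono h]
  rw [numComponents, numComponents, himage]
  exact Finset.card_image_le

theorem numComponents_eq_card (h : ∀ i j, G.Joined t τ (x i) (x j) → i = j) :
    G.numComponents t x τ = Fintype.card ι := by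
  classical
  exact Finset.card_image_of_injective _ fun i j hij => h i j (joined_iff_component_eq.2 hij)

theorem two_le_numComponents {i j : ι} (h : ¬ G.Joined t τ (x i) (x j)) :
    2 ≤ G.numComponents t x τ := by
  classical
  exact Finset.one_lt_card.2 ⟨_, Finset.mem_image_of_mem _ (Finset.mem_univ i), _,
    Finset.mem_image_of_mem _ (Finset.mem_univ j), fun hij => h (joined_iff_component_eq.2 hij)⟩

theorem numComponents_add_le_one_add {r : ℝ} (hr : ∀ i, r ≤ ρ i)
    (hjoined : ∀ i, ρ i ≤ τ → G.Joined t τ q (x i)) :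
    (G.numComponents t x τ + if τ < r then 1 else 0 : ℝ) ≤
      1 + ∑ i, if τ < ρ i then 1 else 0 := by
  classical
  rw [Finset.sum_boole]
  split_ifs with hτ
  · rw [Finset.filter_true_of_mem fun i _ => hτ.trans_le (hr i), add_comm]
    gcongr
    exact Finset.card_image_le
  · have hsub : (Finset.univ.image fun i => G.component (G.stateAt t τ) (x i)) ⊆
        insert (G.component (G.stateAt t τ) q)
          ({i | τ < ρ i}.toFinset.image fun i => G.component (G.stateAt t τ) (x i)) := by
      refine Finset.image_subset_iff.2 fun i _ => Finset.mem_insert.2 ?_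
      refine (le_or_gt (ρ i) τ).imp (fun h => (joined_iff_component_eq.1 (hjoined i h)).symm)
        fun h => Finset.mem_image_of_mem _ (by simpa using h)
    have hcard : G.numComponents t x τ ≤ 1 + (Finset.univ.filter fun i => τ < ρ i).card := by
      refine (Finset.card_le_card hsub).trans ((Finset.card_insert_le _ _).trans ?_)
      rw [add_comm]
      gcongr
      refine Finset.card_image_le.trans_eq ?_
      simp
    rw [add_zero]
    exact_mod_cast hcard

theorem integrable_indicator_numComponents_sub_one :
    Integrable (Set.indicator (Set.Ico 0 M) fun τ => (G.numComponents t x τ - 1 : ℝ)) := by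
  refine (integrable_indicator_iff measurableSet_Ico).2 ?_
  refine IntegrableOn.mono_set ?_ Set.Ico_subset_Icc_self
  refine IntegrableOn.sub ?_ (integrableOn_const measure_Icc_lt_top.ne)
  exact AntitoneOn.integrableOn_isCompact isCompact_Icc
    fun _ _ _ _ h => Nat.cast_le.2 (numComponents_antitone h)

theorem integrable_indicator_Ico {r s : ℝ} :
    Integrable (Set.indicator (Set.Ico r s) (1 : ℝ → ℝ)) :=
  (integrable_indicator_iff measurableSet_Ico).2 (integrableOn_const measure_Ico_lt_top.ne)

theorem integral_indicator_Ico {r : ℝ} (hr : 0 ≤ r) :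
    ∫ τ, Set.indicator (Set.Ico 0 r) (1 : ℝ → ℝ) τ = r := by
  rw [integral_indicator_one measurableSet_Ico, Real.volume_real_Ico_of_le hr, sub_zero]

theorem integral_numComponents_sub_one_le_sum (hρ : ∀ i, 0 ≤ ρ i)
    (hjoined : ∀ τ ∈ Set.Ico 0 M, ∀ i, ρ i ≤ τ → G.Joined t τ q (x i)) :
    ∫ τ in Set.Ico 0 M, (G.numComponents t x τ - 1 : ℝ) ≤ ∑ i, ρ i := by
  calc ∫ τ in Set.Ico 0 M, (G.numComponents t x τ - 1 : ℝ)
    _ = ∫ τ, Set.indicator (Set.Ico 0 M) (fun τ => (G.numComponents t x τ - 1 : ℝ)) τ :=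
      (integral_indicator measurableSet_Ico).symm
    _ ≤ ∫ τ, ∑ i, Set.indicator (Set.Ico 0 (ρ i)) (1 : ℝ → ℝ) τ := by
      refine integral_mono integrable_indicator_numComponents_sub_one
        (integrable_finsetSum _ fun i _ => integrable_indicator_Ico) fun τ => ?_
      refine Set.indicator_apply_le' (fun hτ => ?_) fun _ =>
        Finset.sum_nonneg fun i _ => Set.indicator_nonneg (fun _ _ => zero_le_one) τ
      have hcount := numComponents_add_le_one_add hρ (hjoined τ hτ)
      rw [if_neg hτ.1.not_gt] at hcount
      simp only [Set.indicator_apply, Set.mem_Ico, hτ.1, true_and, Pi.one_apply]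
      linarith
    _ = ∑ i, ρ i := by
      rw [integral_finsetSum _ fun i _ => integrable_indicator_Ico]
      exact Finset.sum_congr rfl fun i _ => integral_indicator_Ico (hρ i)

theorem weightedRate_boost_add_numComponents_le {σ : ℝ≥0} (hβ : 0 ≤ β) (hσ : t' q ≤ σ) (hτ : 0 ≤ τ)
    (hx : ∀ i, G.VertexGrowsAt t' τ (x i)) :
    G.weightedRate t β (boost t' q σ) τ + G.numComponents t' x τ ≤
      G.weightedRate t β t' τ + G.numComponents (boost t' q σ) x τ +
        if τ < σ then 1 + β else 0 := by
  have hmerge := weightedRate_add_numComponents_le (t := t) (q := q) (t₂ := boost t' q σ) hβ hτ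
    (fun a b hab => hab.mono_fingerprint (le_boost hσ) hτ)
    (fun a ha h => by rwa [boost_of_ne ha] at h) hx
  rwa [boost_self] at hmerge

theorem weightedRate_boost_le {σ : ℝ≥0} (hβ : 0 ≤ β) (hσ : t' q ≤ σ) (hστ : σ ≤ τ) :
    G.weightedRate t β (boost t' q σ) τ ≤ G.weightedRate t β t' τ := by
  have hmerge := weightedRate_boost_add_numComponents_le (G := G) (t := t) (x := Fin.elim0) hβ hσ
    (σ.coe_nonneg.trans hστ) (Fin.elim0 ·)
  simpa [numComponents, hστ.not_gt] using hmerge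

theorem weightedRate_boost_add_indicator_le {σ : ℝ≥0} (hβ : 0 ≤ β) (hσ : t' q ≤ σ) (hσM : σ ≤ M)
    (hσρ : ∀ i, σ ≤ ρ i) (hgrows : ∀ τ ∈ Set.Ico 0 M, ∀ i, G.VertexGrowsAt t' τ (x i))
    (hjoined : ∀ τ ∈ Set.Ico 0 M, ∀ i, ρ i ≤ τ → G.Joined (boost t' q σ) τ q (x i)) :
    G.weightedRate t β (boost t' q σ) τ +
        Set.indicator (Set.Ico 0 M) (fun τ => (G.numComponents t' x τ - 1 : ℝ)) τ ≤
      G.weightedRate t β t' τ + (∑ i, Set.indicator (Set.Ico 0 (ρ i)) (1 : ℝ → ℝ) τ +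
        β * Set.indicator (Set.Ico 0 (σ : ℝ)) (1 : ℝ → ℝ) τ) := by
  have hsum : 0 ≤ ∑ i, Set.indicator (Set.Ico 0 (ρ i)) (1 : ℝ → ℝ) τ :=
    Finset.sum_nonneg fun i _ => Set.indicator_nonneg (fun _ _ => zero_le_one) τ
  obtain hτ0 | hτ0 := lt_or_ge τ 0
  · simp [weightedRate_of_neg hτ0, hτ0.not_ge]
  obtain hτM | hτM := le_or_gt M τ
  · have hle := weightedRate_boost_le (G := G) (t := t) hβ hσ (hσM.trans hτM)
    simp only [Set.indicator_of_notMem (s := Set.Ico 0 M) fun hτ => hτ.2.not_ge hτM,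
      Set.indicator_of_notMem (s := Set.Ico 0 (σ : ℝ)) fun hτ => hτ.2.not_ge (hσM.trans hτM)]
    linarith
  · have hmerge := weightedRate_boost_add_numComponents_le (t := t) hβ hσ hτ0 (hgrows τ ⟨hτ0, hτM⟩)
    have hcount := numComponents_add_le_one_add hσρ (hjoined τ ⟨hτ0, hτM⟩)
    have hβσ : (if τ < σ then 1 + β else 0) =
        (if τ < σ then 1 else 0) + β * if τ < σ then 1 else 0 := by split_ifs <;> simp
    simp only [Set.indicator_apply, Set.mem_Ico, hτ0, hτM, true_and, Pi.one_apply, if_true]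
    linarith

theorem integral_weightedRate_boost_add_le {σ : ℝ≥0} (hβ : 0 ≤ β) (hσ : t' q ≤ σ) (hσM : σ ≤ M)
    (hσρ : ∀ i, σ ≤ ρ i) (hgrows : ∀ τ ∈ Set.Ico 0 M, ∀ i, G.VertexGrowsAt t' τ (x i))
    (hjoined : ∀ τ ∈ Set.Ico 0 M, ∀ i, ρ i ≤ τ → G.Joined (boost t' q σ) τ q (x i)) :
    (∫ τ, G.weightedRate t β (boost t' q σ) τ) +
        ∫ τ in Set.Ico 0 M, (G.numComponents t' x τ - 1 : ℝ) ≤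
      (∫ τ, G.weightedRate t β t' τ) + (∑ i, ρ i + β * σ) := by
  have hρ : Integrable fun τ => ∑ i, Set.indicator (Set.Ico 0 (ρ i)) (1 : ℝ → ℝ) τ :=
    integrable_finsetSum _ fun i _ => integrable_indicator_Ico
  have hσ' : Integrable fun τ => β * Set.indicator (Set.Ico 0 (σ : ℝ)) (1 : ℝ → ℝ) τ :=
    integrable_indicator_Ico.const_mul β
  calc (∫ τ, G.weightedRate t β (boost t' q σ) τ) +
        ∫ τ in Set.Ico 0 M, (G.numComponents t' x τ - 1 : ℝ)
    _ = ∫ τ, (G.weightedRate t β (boost t' q σ) τ +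
        Set.indicator (Set.Ico 0 M) (fun τ => (G.numComponents t' x τ - 1 : ℝ)) τ) := by
      rw [integral_add integrable_weightedRate integrable_indicator_numComponents_sub_one,
        integral_indicator measurableSet_Ico]
    _ ≤ ∫ τ, (G.weightedRate t β t' τ + (∑ i, Set.indicator (Set.Ico 0 (ρ i)) (1 : ℝ → ℝ) τ +
        β * Set.indicator (Set.Ico 0 (σ : ℝ)) (1 : ℝ → ℝ) τ)) :=
      integral_mono (integrable_weightedRate.add integrable_indicator_numComponents_sub_one)
        (integrable_weightedRate.add (hρ.add hσ')) fun _ =>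
          weightedRate_boost_add_indicator_le hβ hσ hσM hσρ hgrows hjoined
    _ = (∫ τ, G.weightedRate t β t' τ) + (∑ i, ρ i + β * σ) := by
      rw [integral_add integrable_weightedRate, integral_add hρ hσ', integral_const_mul,
        integral_finsetSum _ fun i _ => integrable_indicator_Ico,
        integral_indicator_Ico σ.coe_nonneg]
      · simp only [integral_indicator_Ico (σ.coe_nonneg.trans (hσρ _))]
      · exact hρ.add hσ'

theorem integral_numComponents_sub_one_le_of_not_isValuable {σ : ℝ≥0} (hβ : 0 ≤ β) (hσ : t' q ≤ σ)
    (hσM : σ ≤ M) (hσρ : ∀ i, σ ≤ ρ i)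
    (hgrows : ∀ τ ∈ Set.Ico 0 M, ∀ i, G.VertexGrowsAt t' τ (x i))
    (hjoined : ∀ τ ∈ Set.Ico 0 M, ∀ i, ρ i ≤ τ → G.Joined (boost t' q σ) τ q (x i))
    (hnot : ¬ G.IsValuable t β t' q σ) :
    ∫ τ in Set.Ico 0 M, (G.numComponents t' x τ - 1 : ℝ) ≤ ∑ i, ρ i + β * σ := by
  have hle := integral_weightedRate_boost_add_le (t := t) hβ hσ hσM hσρ hgrows hjoined
  rw [isValuable_iff_integral_weightedRate_le, not_le] at hnot
  linarith

/-! ### Boosts -/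

/-- Once `q` has joined the growing set of `u`, the time assigned to `q` no longer matters. -/
theorem Joined.boost_of_joined {T σ : ℝ≥0} {r : ℝ} (hσ : t' q ≤ σ) (hrσ : r ≤ σ)
    (hu : ∀ τ ∈ Set.Ico 0 M, G.VertexGrowsAt t' τ u) (hqu : G.Joined (boost t' q T) r q u)
    (hτ : 0 ≤ τ) (hτM : τ ≤ M) (hab : G.Joined (boost t' q T) τ a b) :
    G.Joined (boost t' q σ) τ a b := by
  have hgrows : ∀ x : ℝ, ∀ a, (a = q → x < σ) → x < boost t' q T a →
      G.VertexGrowsAt (boost t' q σ) x a := fun x a ha hx => by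
    obtain rfl | hne := eq_or_ne a q
    · exact vertexGrowsAt_of_lt (boost_self ▸ ha rfl)
    · rw [boost_of_ne hne] at hx
      exact vertexGrowsAt_of_lt (by rwa [boost_of_ne hne])
  have hbefore : ∀ x ∈ Set.Icc (0 : ℝ) σ, ∀ a b,
      G.Joined (boost t' q T) x a b → G.Joined (boost t' q σ) x a b := fun x hx a b =>
    Joined.of_vertexGrowsAt (fun y hy a => hgrows y a fun _ => hy.2) hx.1 hx.2
  refine Joined.of_vertexGrowsAt (fun x hx a hxa => ?_) hτ hτM hab
  obtain hxσ | hσx := lt_or_ge x σ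
  · exact hgrows x a (fun _ => hxσ) hxa
  obtain rfl | hne := eq_or_ne a q
  · have hqu' : G.Joined (boost t' a σ) x a u :=
      (hbefore σ ⟨σ.coe_nonneg, le_rfl⟩ a u (hqu.mono hrσ)).mono hσx
    exact hqu'.vertexGrowsAt_iff.2 ((hu x hx).mono_fingerprint (le_boost hσ) hx.1)
  · exact hgrows x a (fun h => absurd h hne) hxa

theorem isCandidate_of_first_joined {T σ : ℝ≥0} (hσ : t' q < σ) (hσM : σ ≤ M)
    (hMT : M ≤ T) (hu : ∀ τ ∈ Set.Ico 0 M, G.VertexGrowsAt t' τ u)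
    (hlt : ∀ τ ∈ Set.Ico (0 : ℝ) σ, ¬ G.Joined (boost t' q T) τ q u)
    (hjoined : G.Joined (boost t' q T) σ q u) : G.IsCandidate t' q σ := by
  have hσT : (σ : ℝ) ≤ T := hσM.trans hMT
  refine ⟨hσ, (Filter.eventually_ge_atTop T).mono fun T' hT' => ?_⟩
  have hσT' : (σ : ℝ) ≤ T' := hσT.trans (NNReal.coe_le_coe.2 hT')
  have hle : t' q ≤ T' := hσ.le.trans (NNReal.coe_le_coe.1 hσT')
  refine exists_growsUntil_of_first_joined (NNReal.coe_pos.2 (hσ.trans_le' zero_le))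
    (fun τ hτ h => hlt τ hτ ?_) (fun τ hτ => vertexGrowsAt_of_lt ?_)
    (fun τ hτ => (hu τ ⟨hτ.1, hτ.2.trans_le hσM⟩).mono_fingerprint (le_boost hle) hτ.1) ?_
  · exact h.boost_of_joined (hσ.le.trans (NNReal.coe_le_coe.1 hσT)) (hτ.2.le.trans hσT) hu hτ.1
      (hτ.2.le.trans hσM) h
  · rw [boost_self]
    exact hτ.2.trans_le hσT'
  · exact hjoined.boost_of_joined hle hσT' hu σ.coe_nonneg hσM hjoined

theorem integral_numComponents_sub_one_le_of_first_joined {T : ℝ≥0} (hβ : 0 ≤ β)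
    (hopt : ∀ σ, G.IsCandidate t' q σ → ¬ G.IsValuable t β t' q σ) (hMT : M ≤ T)
    (hgrows : ∀ τ ∈ Set.Ico 0 M, ∀ i, G.VertexGrowsAt t' τ (x i)) (hρ : ∀ i, 0 ≤ ρ i)
    (hjoined : ∀ i, ∀ τ ∈ Set.Ico 0 M, G.Joined (boost t' q T) τ q (x i) ↔ ρ i ≤ τ) {i₀ : ι}
    (hmin : ∀ i, ρ i₀ ≤ ρ i) :
    ∫ τ in Set.Ico 0 M, (G.numComponents t' x τ - 1 : ℝ) ≤ ∑ i, ρ i + β * ρ i₀ := by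
  have htransfer : ∀ σ : ℝ≥0, t' q ≤ σ → ρ i₀ ≤ σ → ∀ τ ∈ Set.Ico 0 M, ∀ i, ρ i ≤ τ →
      G.Joined (boost t' q σ) τ q (x i) := fun σ hσ hρσ τ hτ i hi =>
    Joined.boost_of_joined hσ hρσ (fun τ hτ => hgrows τ hτ i₀)
      ((hjoined i₀ _ ⟨hρ i₀, (hmin i).trans_lt (hi.trans_lt hτ.2)⟩).2 le_rfl) hτ.1 hτ.2.le
      ((hjoined i τ hτ).2 hi)
  by_cases hcase : t' q < ρ i₀ ∧ ρ i₀ < M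
  · obtain ⟨hq, hM⟩ := hcase
    lift ρ i₀ to ℝ≥0 using hρ i₀ with σ hσ
    rw [NNReal.coe_lt_coe] at hq
    have hcand : G.IsCandidate t' q σ := isCandidate_of_first_joined hq hM.le hMT
      (fun τ hτ => hgrows τ hτ i₀)
      (fun τ hτ h => hτ.2.not_ge (hσ ▸ (hjoined i₀ τ ⟨hτ.1, hτ.2.trans hM⟩).1 h))
      ((hjoined i₀ σ ⟨σ.coe_nonneg, hM⟩).2 hσ.ge)
    exact integral_numComponents_sub_one_le_of_not_isValuable hβ hq.le hM.le hmin hgrows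
      (htransfer σ hq.le le_rfl) (hopt σ hcand)
  · refine (integral_numComponents_sub_one_le_sum (q := q) hρ fun τ hτ i hi => ?_).trans
      (le_add_of_nonneg_right (mul_nonneg hβ (hρ i₀)))
    have hM : ρ i₀ < M := (hmin i).trans_lt (hi.trans_lt hτ.2)
    have hq : ρ i₀ ≤ t' q := not_lt.1 fun hq => hcase ⟨hq, hM⟩
    exact boost_eq_self (t := t') ▸ htransfer (t' q) le_rfl hq τ hτ i hi

theorem ofReal_integral_numComponents_sub_one_le (hβ : 0 ≤ β) (hM : 0 ≤ M)
    (hopt : ∀ σ, G.IsCandidate t' q σ → ¬ G.IsValuable t β t' q σ)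
    (hgrows : ∀ τ ∈ Set.Ico 0 M, ∀ i, G.VertexGrowsAt t' τ (x i)) (j : ι) :
    ENNReal.ofReal (∫ τ in Set.Ico 0 M, (G.numComponents t' x τ - 1 : ℝ)) ≤
      ∑ i, G.dist q (x i) / 2 + ENNReal.ofReal β * (G.dist q (x j) / 2) := by
  have : Nonempty ι := ⟨j⟩
  have hq : t' q ≤ max (t' q) M.toNNReal := le_max_left _ _
  have hMT : M ≤ (max (t' q) M.toNNReal : ℝ≥0) :=
    (Real.le_coe_toNNReal M).trans (NNReal.coe_le_coe.2 (le_max_right _ _))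
  generalize max (t' q) M.toNNReal = T at hq hMT
  choose ρ hρ hρM hjoined using fun i =>
    exists_first_joined (G := G) (t := boost t' q T) q (x i) hM
  have hdist : ∀ i, ENNReal.ofReal (ρ i) ≤ G.dist q (x i) / 2 := fun i => by
    refine ofReal_le_dist_div_two (t := boost t' q T) (hρ i)
      (fun τ hτ h => ?_) (fun τ hτ => vertexGrowsAt_of_lt ?_) fun τ hτ => ?_
    · exact hτ.2.not_ge ((hjoined i τ ⟨hτ.1, hτ.2.trans_le (hρM i)⟩).1 h)
    · rw [boost_self]
      exact hτ.2.trans_le ((hρM i).trans hMT)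
    · exact (hgrows τ ⟨hτ.1, hτ.2.trans_le (hρM i)⟩ i).mono_fingerprint (le_boost hq) hτ.1
  obtain ⟨i₀, hmin⟩ := Finite.exists_min ρ
  calc ENNReal.ofReal (∫ τ in Set.Ico 0 M, (G.numComponents t' x τ - 1 : ℝ))
    _ ≤ ENNReal.ofReal (∑ i, ρ i + β * ρ i₀) := ENNReal.ofReal_le_ofReal
      (integral_numComponents_sub_one_le_of_first_joined hβ hopt hMT hgrows hρ hjoined hmin)
    _ ≤ ENNReal.ofReal (∑ i, ρ i + β * ρ j) := by gcongr; exact hmin j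
    _ = ∑ i, ENNReal.ofReal (ρ i) + ENNReal.ofReal β * ENNReal.ofReal (ρ j) := by
      rw [ENNReal.ofReal_add (Finset.sum_nonneg fun i _ => hρ i) (mul_nonneg hβ (hρ j)),
        ENNReal.ofReal_sum_of_nonneg fun i _ => hρ i, ENNReal.ofReal_mul hβ]
    _ ≤ ∑ i, G.dist q (x i) / 2 + ENNReal.ofReal β * (G.dist q (x j) / 2) := by
      gcongr with i
      exacts [hdist i, hdist j]

/-! ### First moments -/

theorem IsActiveAt.nonneg (h : G.IsActiveAt t τ S) : 0 ≤ τ :=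
  let ⟨⟨_, hn, _⟩, _⟩ := h
  hn.nonneg

/-- The first moment need not be an event: a set that is formed and deactivated at once is active
then, but does not grow. -/
theorem exists_isLeast_isActiveAt {Q : Finset V → Prop} (hσ : ∃ S, G.IsActiveAt t σ S ∧ Q S)
    (hgrows : ∀ τ ∈ Set.Ico 0 σ, ∀ S, Q S → ∃ a ∈ S, G.VertexGrowsAt t τ a) :
    ∃ τ ∈ Set.Icc 0 σ, IsLeast {τ | ∃ S, G.IsActiveAt t τ S ∧ Q S} τ ∧
      ∀ x ∈ Set.Ico 0 τ, ∀ a, ¬ Q (G.component (G.stateAt t x) a) := by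
  have hactive : ∀ τ ∈ Set.Ico 0 σ, ∀ a, Q (G.component (G.stateAt t τ) a) →
      ∃ S, G.IsActiveAt t τ S ∧ Q S := fun τ hτ a ha => by
    obtain ⟨b, hb, hgb⟩ := hgrows τ hτ _ ha
    refine ⟨_, ⟨(isComponentAt_iff hτ.1).2 (mem_components.2 ⟨a, rfl⟩), .inl ?_⟩, ha⟩
    rw [growsAt_iff hτ.1]
    rwa [VertexGrowsAt, ← component_eq_iff.2 (mem_component.1 hb)] at hgb
  obtain ⟨τ, hleast⟩ := exists_isLeast_of_frequently_nhdsGE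
    (B := {τ | τ ≤ σ ∧ ∃ S, G.IsActiveAt t τ S ∧ Q S}) (m := 0) ⟨σ, le_rfl, hσ⟩
    (fun τ ⟨_, S, hS, _⟩ => hS.nonneg) fun τ hτ hfreq => by
      obtain ⟨x, ⟨hxσ, S, hS, hQ⟩, hx, hcomponent⟩ := (hfreq.and_eventually
        (eventually_mem_nhdsWithin.and (eventually_component_stateAt_eq G t hτ))).exists
      obtain rfl | hτσ := (hx.trans hxσ : τ ≤ σ).eq_or_lt
      · exact ⟨le_rfl, hσ⟩
      · obtain ⟨a, rfl⟩ := mem_components.1 ((isComponentAt_iff (hτ.trans hx)).1 hS.1)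
        exact ⟨hτσ.le, hactive τ ⟨hτ, hτσ⟩ a (hcomponent a ▸ hQ)⟩
  have hτσ := hleast.1.1
  have hτ0 : 0 ≤ τ := hleast.1.2.elim fun _ hS => hS.1.nonneg
  refine ⟨τ, ⟨hτ0, hτσ⟩, ⟨hleast.1.2, fun x hx => ?_⟩, fun x hx a ha => ?_⟩
  · exact (le_total x σ).elim (fun hxσ => hleast.2 ⟨hxσ, hx⟩) hτσ.trans
  · exact hx.2.not_ge (hleast.2 ⟨hx.2.le.trans hτσ, hactive x ⟨hx.1, hx.2.trans_le hτσ⟩ a ha⟩)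

theorem add_le_integral_numComponents_sub_one {τ' : ℝ} (hτ : 0 ≤ τ) (hττ' : τ ≤ τ')
    (hpair : ∀ σ ∈ Set.Ico 0 τ, ¬ G.Joined t σ u v ∧ ¬ G.Joined t σ u w ∧ ¬ G.Joined t σ v w)
    (htriple : ∀ σ ∈ Set.Ico 0 τ', ¬ (G.Joined t σ u v ∧ G.Joined t σ u w)) :
    τ + τ' ≤ ∫ σ in Set.Ico 0 τ', (G.numComponents t ![u, v, w] σ - 1 : ℝ) := by
  have hthree : ∀ σ ∈ Set.Ico 0 τ, G.numComponents t ![u, v, w] σ = 3 := fun σ hσ => by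
    specialize hpair σ hσ
    refine (numComponents_eq_card fun i j h => ?_).trans (Fintype.card_fin 3)
    fin_cases i <;> fin_cases j <;> simp_all [Joined.comm (b := u), Joined.comm (b := v) (a := w)]
  have htwo : ∀ σ ∈ Set.Ico 0 τ', 2 ≤ G.numComponents t ![u, v, w] σ := fun σ hσ =>
    (not_and_or.1 (htriple σ hσ)).elim
      (fun h => two_le_numComponents (x := ![u, v, w]) (i := 0) (j := 1) h)
      fun h => two_le_numComponents (x := ![u, v, w]) (i := 0) (j := 2) h
  rw [← integral_indicator measurableSet_Ico]
  nth_rw 1 [← integral_indicator_Ico hτ, ← integral_indicator_Ico (hτ.trans hττ')]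
  rw [← integral_add integrable_indicator_Ico integrable_indicator_Ico]
  refine integral_mono (integrable_indicator_Ico.add integrable_indicator_Ico)
    integrable_indicator_numComponents_sub_one fun σ => ?_
  by_cases hσ' : σ ∈ Set.Ico 0 τ'
  · have htwo' : (2 : ℝ) ≤ G.numComponents t ![u, v, w] σ := by exact_mod_cast htwo σ hσ'
    by_cases hσ : σ ∈ Set.Ico 0 τ
    · simp only [Set.indicator_of_mem hσ, Set.indicator_of_mem hσ', hthree σ hσ]
      norm_num
    · simp only [Set.indicator_of_notMem hσ, Set.indicator_of_mem hσ', Pi.one_apply]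
      linarith
  · have hσ : σ ∉ Set.Ico 0 τ := fun h => hσ' ⟨h.1, h.2.trans_le hττ'⟩
    simp [Set.indicator_of_notMem hσ, Set.indicator_of_notMem hσ']

theorem ActivelyConnected.vertexGrowsAt {A : Set V} (h : G.ActivelyConnected t A) :
    ∃ σ, (∃ S, G.IsActiveAt t σ S ∧ A ⊆ S) ∧
      ∀ τ ∈ Set.Ico 0 σ, ∀ a ∈ A, G.VertexGrowsAt t τ a :=
  let ⟨σ, hσ, hgrows⟩ := h
  ⟨σ, hσ, fun τ hτ a ha => (vertexGrowsAt_iff_exists_growsAt hτ.1).2 (hgrows a ha τ hτ.1 hτ.2)⟩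

theorem ActivelyConnected.exists_isLeast (huvw : G.ActivelyConnected t {u, v, w}) :
    ∃ τ τ' : ℝ,
      IsLeast {σ | ∃ S, G.IsActiveAt t σ S ∧
        ((u ∈ S ∧ v ∈ S) ∨ (u ∈ S ∧ w ∈ S) ∨ (v ∈ S ∧ w ∈ S))} τ ∧
      IsLeast {σ | ∃ S, G.IsActiveAt t σ S ∧ u ∈ S ∧ v ∈ S ∧ w ∈ S} τ' ∧ 0 ≤ τ' ∧
      (∀ σ ∈ Set.Ico 0 τ', ∀ i, G.VertexGrowsAt t σ (![u, v, w] i)) ∧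
      τ + τ' ≤ ∫ σ in Set.Ico 0 τ', (G.numComponents t ![u, v, w] σ - 1 : ℝ) := by
  obtain ⟨ω, ⟨S, hS, hsub⟩, hgrows⟩ := huvw.vertexGrowsAt
  obtain ⟨hu, hv, hw⟩ : u ∈ S ∧ v ∈ S ∧ w ∈ S := by simpa [Set.insert_subset_iff] using hsub
  obtain ⟨τ', hτ', hleast', htriple⟩ := exists_isLeast_isActiveAt
    (Q := fun S => u ∈ S ∧ v ∈ S ∧ w ∈ S) ⟨S, hS, hu, hv, hw⟩
    fun σ hσ S h => ⟨u, h.1, hgrows σ hσ u (by simp)⟩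
  obtain ⟨τ, hτ, hleast, hpair⟩ := exists_isLeast_isActiveAt
    (Q := fun S => (u ∈ S ∧ v ∈ S) ∨ (u ∈ S ∧ w ∈ S) ∨ (v ∈ S ∧ w ∈ S)) ⟨S, hS, .inl ⟨hu, hv⟩⟩
    fun σ hσ S h => by
      obtain h | h | h := h
      exacts [⟨u, h.1, hgrows σ hσ u (by simp)⟩, ⟨u, h.1, hgrows σ hσ u (by simp)⟩,
        ⟨v, h.1, hgrows σ hσ v (by simp)⟩]
  have hττ' : τ ≤ τ' := hleast.2 (hleast'.1.imp fun S h => ⟨h.1, .inl ⟨h.2.1, h.2.2.1⟩⟩)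
  refine ⟨τ, τ', hleast, hleast', hτ'.1, fun σ hσ i => hgrows σ ⟨hσ.1, hσ.2.trans_le hτ'.2⟩ _ ?_,
    add_le_integral_numComponents_sub_one hτ.1 hττ' (fun σ hσ => ?_) fun σ hσ h => ?_⟩
  · fin_cases i <;> simp
  · exact ⟨fun h => hpair σ hσ u (.inl ⟨self_mem_component, mem_component.2 h⟩),
      fun h => hpair σ hσ u (.inr (.inl ⟨self_mem_component, mem_component.2 h⟩)),
      fun h => hpair σ hσ v (.inr (.inr ⟨self_mem_component, mem_component.2 h⟩))⟩
  · exact htriple σ hσ u ⟨self_mem_component, mem_component.2 h.1, mem_component.2 h.2⟩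

end CostGraph

theorem mainTheorem3_general {V : Type*} [Fintype V] (G : CostGraph V) (t t' : V → ℝ≥0) (β : ℝ)
    (hβ : 0 ≤ β) (hopt : ∀ a σ, G.IsCandidate t' a σ → ¬ G.IsValuable t β t' a σ)
    (u v w : V) (huvw : G.ActivelyConnected t' {u, v, w}) :
    ∃ τ τ' : ℝ,
      IsLeast {σ | ∃ S, G.IsActiveAt t' σ S ∧
        ((u ∈ S ∧ v ∈ S) ∨ (u ∈ S ∧ w ∈ S) ∨ (v ∈ S ∧ w ∈ S))} τ ∧
      IsLeast {σ | ∃ S, G.IsActiveAt t' σ S ∧ u ∈ S ∧ v ∈ S ∧ w ∈ S} τ' ∧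
      ∀ q : V, ENNReal.ofReal (τ + τ') ≤
        (G.dist q u + G.dist q v + G.dist q w) / 2 +
          ENNReal.ofReal β * (min (G.dist q u) (min (G.dist q v) (G.dist q w)) / 2) := by
  obtain ⟨τ, τ', hleast, hleast', hτ', hgrows, hle⟩ := huvw.exists_isLeast
  refine ⟨τ, τ', hleast, hleast', fun q => ?_⟩
  have hbound : ∀ j, ENNReal.ofReal (τ + τ') ≤ (G.dist q u + G.dist q v + G.dist q w) / 2 +
      ENNReal.ofReal β * (G.dist q (![u, v, w] j) / 2) := fun j => by
    simpa [Fin.sum_univ_three, ENNReal.add_div] using (ENNReal.ofReal_le_ofReal hle).trans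
      (CostGraph.ofReal_integral_numComponents_sub_one_le hβ hτ' (hopt q) hgrows j)
  obtain h | h := min_choice (G.dist q u) (min (G.dist q v) (G.dist q w))
  · exact h.symm ▸ hbound 0
  obtain h' | h' := min_choice (G.dist q v) (G.dist q w)
  exacts [(h.trans h').symm ▸ hbound 1, (h.trans h').symm ▸ hbound 2]

theorem mainTheorem3 {V : Type*} [Fintype V] (G : CostGraph V) (t t' : V → ℝ≥0) (β : ℝ)
    (hβ0 : 0 < β) (hβ1 : β < 1) (hLS : G.IsLocalSearchOutput t β t')
    (u v w : V) (huvw : G.ActivelyConnected t' {u, v, w}) :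
    ∃ τ τ' : ℝ,
      IsLeast {σ | ∃ S, G.IsActiveAt t' σ S ∧
        ((u ∈ S ∧ v ∈ S) ∨ (u ∈ S ∧ w ∈ S) ∨ (v ∈ S ∧ w ∈ S))} τ ∧
      IsLeast {σ | ∃ S, G.IsActiveAt t' σ S ∧ u ∈ S ∧ v ∈ S ∧ w ∈ S} τ' ∧
      ∀ q : V, ENNReal.ofReal (τ + τ') ≤
        (G.dist q u + G.dist q v + G.dist q w) / 2 +
          ENNReal.ofReal β * (min (G.dist q u) (min (G.dist q v) (G.dist q w)) / 2) :=
  mainTheorem3_general G t t' β hβ0.le hLS.2 u v w huvw
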